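/- Consider a base station with $M$ antennas and $K$ users with $N$ antennas each, with channel matrices $H_i\in\mathbb{C}^{N\times M}$, noise variance $\sigma^2>0$, bandwidth $W>0$, power amplifier efficiency $\eta>0$, dynamic power $P_{\rm dyn}$ per active antenna and static power $P_{\rm sta}$. Fix an active antenna set $\mathcal T\subseteq\{1,\dots,M\}$ with $M_a=|\mathcal T|$, let $H_{\mathcal T,i}\in\mathbb{C}^{N\times M_a}$ consist of the columns of $H_i$ indexed by $\mathcal T$, and assume that $M_aP_{\rm dyn}+P_{\rm sta}>0$ and that $H_{\mathcal T,i}\neq 0$ for every $i$. For positive semidefinite $Q_1,\dots,Q_K\in\mathbb{C}^{N\times N}$ define the energy efficiency (EE) $$g(Q_1,\dots,Q_K)=\frac{W\log_2\det\bigl(I+\frac1{\sigma^2}\sum_{i=1}^K H_{\mathcal T,i}^{H}Q_iH_{\mathcal T,i}\bigr)}{\frac1\eta\sum_{i=1}^K\operatorname{Tr}(Q_i)+M_aP_{\rm dyn}+P_{\rm sta}}.$$ Then: 1. For all positive semidefinite $Q_1,\dots,Q_K$ and every $i$, the function $A\mapsto g(Q_1,\dots,Q_{i-1},A,Q_{i+1},\dots,Q_K)$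 has exactly one maximizer over the positive semidefinite matrices $A\in\mathbb{C}^{N\times N}$. 2. Let $Q^{(0)}=(Q^{(0)}_1,\dots,Q^{(0)}_K)$ be any tuple of positive semidefinite matrices (for example all zero). Then there is exactly one sequence $Q^{(k)}$, $k\ge 0$, starting at $Q^{(0)}$ and such that for all $k\ge 0$ and $i=1,\dots,K$ $$Q_i^{(k+1)}=\arg\max_{A\succeq 0}\, g\bigl(Q_1^{(k+1)},\dots,Q_{i-1}^{(k+1)},A,Q_{i+1}^{(k)},\dots,Q_K^{(k)}\bigr).$$ For this sequence, $g$ does not decrease in any single update of one user's matrix, and hence $g(Q^{(k)})$ is non-decreasing in $k$. The iterates $Q^{(k)}$ converge to a tuple $Q^\star$ of positive semidefinite matrices, the EE values $g(Q^{(k)})$ converge to $g(Q^\star)$, and $Q^\star$ is a global maximizer of $g$ over all tuples of positive semidefinite matrices, i.e. of the unconstrained EE problem (P1). -/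

import Mathlib

open Filter Topology
open scoped ComplexOrder

noncomputable section

/-- Data of a MIMO broadcast channel with `M` base station antennas and `K` users having `N`
antennas each, together with the affine power consumption model. -/
structure MIMOBC (K N M : ℕ) where
  /-- channel matrix from the base station to each user -/
  H : Fin K → Matrix (Fin N) (Fin M) ℂ
  /-- noise standard deviation (the noise variance is `σ ^ 2`) -/
  σ : ℝ
  /-- bandwidth -/
  W : ℝ
  /-- power amplifier efficiency -/
  η : ℝ
  /-- dynamic power per active transmit antenna -/
  Pdyn : ℝ
  /-- static power -/
  Psta : ℝ

/-- A tuple `(Q₁, …, Q_K)` of candidate dual-MAC transmit covariance matrices. -/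
abbrev CovTuple (K N : ℕ) := Fin K → Matrix (Fin N) (Fin N) ℂ

namespace MIMOBC

variable {K N M : ℕ}

/-- The channel matrix of user `i` restricted to the active transmit antennas. -/
def activeH (S : MIMOBC K N M) (T : Finset (Fin M)) (i : Fin K) : Matrix (Fin N) T ℂ :=
  (S.H i).submatrix id (fun a : T => (a : Fin M))

/-- The matrix `I + σ⁻² ∑ᵢ Hᵢᴴ Qᵢ Hᵢ` of the dual multiple access channel. -/
def macMatrix (S : MIMOBC K N M) (T : Finset (Fin M)) (Q : CovTuple K N) : Matrix T T ℂ :=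
  1 + ((1 / S.σ ^ 2 : ℝ) : ℂ) •
    ∑ i, (S.activeH T i).conjTranspose * Q i * S.activeH T i

/-- The sum-rate `W log₂ |I + σ⁻² ∑ᵢ Hᵢᴴ Qᵢ Hᵢ|` (the determinant is a positive real number
whenever all `Qᵢ` are positive semidefinite). -/
def sumRate (S : MIMOBC K N M) (T : Finset (Fin M)) (Q : CovTuple K N) : ℝ :=
  S.W * Real.logb 2 (S.macMatrix T Q).det.re

/-- The transmit independent power `M_a P_dyn + P_sta`, where `M_a = |T|`. -/
def fixedPower (S : MIMOBC K N M) (T : Finset (Fin M)) : ℝ :=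
  (T.card : ℝ) * S.Pdyn + S.Psta

/-- The total power `(∑ᵢ Tr Qᵢ) / η + M_a P_dyn + P_sta`. -/
def totalPower (S : MIMOBC K N M) (T : Finset (Fin M)) (Q : CovTuple K N) : ℝ :=
  (∑ i, (Q i).trace.re) / S.η + S.fixedPower T

/-- The energy efficiency `g(Q₁, …, Q_K)`. -/
def ee (S : MIMOBC K N M) (T : Finset (Fin M)) (Q : CovTuple K N) : ℝ :=
  S.sumRate T Q / S.totalPower T Q

/-- `A` maximizes `g(Q₁, …, Q_{i-1}, ·, Q_{i+1}, …, Q_K)` over the positive semidefinite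
matrices. -/
def IsBlockMaximizer (S : MIMOBC K N M) (T : Finset (Fin M)) (i : Fin K) (Q : CovTuple K N)
    (A : Matrix (Fin N) (Fin N) ℂ) : Prop :=
  A.PosSemidef ∧ ∀ B : Matrix (Fin N) (Fin N) ℂ, B.PosSemidef →
    S.ee T (Function.update Q i B) ≤ S.ee T (Function.update Q i A)

end MIMOBC

/-- The feasible set of the unconstrained problem: all `Qᵢ` are positive semidefinite. -/
def feasibleCov (K N : ℕ) : Set (CovTuple K N) :=
  {Q | ∀ i, (Q i).PosSemidef}

/-- The state inside a sweep, after the first `m` users have been updated. -/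
def midSweep {K N : ℕ} (Qold Qnew : CovTuple K N) (m : ℕ) : CovTuple K N :=
  fun j => if (j : ℕ) < m then Qnew j else Qold j

/-- `Q 0, Q 1, Q 2, …` are the successive sweeps of the iterative water-filling started at `Q₀`:
in sweep `k` the users are updated one after the other, and the new covariance of user `i`
maximizes the energy efficiency, given the already updated covariances of the users before `i`
and the old ones of the users after `i`. -/
def MIMOBC.IsIterativeWaterfilling {K N M : ℕ} (S : MIMOBC K N M) (T : Finset (Fin M))
    (Q₀ : CovTuple K N) (Q : ℕ → CovTuple K N) : Prop :=
  Q 0 = Q₀ ∧ ∀ (k : ℕ) (i : Fin K),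
    S.IsBlockMaximizer T i (midSweep (Q k) (Q (k + 1)) i) (Q (k + 1) i)

end

/-!
The energy efficiency is a concave sum-rate divided by an affine power, hence pseudoconcave, and
its tangent inequality at `P` has the exact defect `W / log 2` times the log-determinant divergence
between the channel matrices at `P` and `Q`. At a block maximizer the first order term is
nonpositive, so each update increases the energy efficiency by at least this divergence, up to the
power. By complementary slackness a block maximizer lies in the range of the channel, where the
channel matrix determines the covariance, so the increase is at least quadratic in the step. This
gives the uniqueness of the updates; their existence is compactness of the superlevel sets.

For the convergence of the whole sequence, the maximizers of the energy efficiency are the positive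
semidefinite solutions of a linear system, and facial reduction shows that the distance to them is
bounded by a power of the optimality gap. Since the gap after a sweep is at most a constant times
the length of the sweep times the distance to a maximizer, this yields an inequality of
Kurdyka-Łojasiewicz type; together with the quadratic increase it makes the step lengths summable.
The same bound on the gap shows that the limit is a maximizer.
-/

/-! ### Log-determinant divergence -/

section Matrices

open Matrix
open scoped Matrix.Norms.L2Operator MatrixOrder

theorem posDef_of_posSemidef_sub_one {n : Type*} [DecidableEq n] {A : Matrix n n ℂ}
    (hA : (A - 1).PosSemidef) : A.PosDef :=
  sub_add_cancel A 1 ▸ PosDef.posSemidef_add hA PosDef.one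

theorem convex_setOf_posSemidef {n : Type*} : Convex ℝ {A : Matrix n n ℂ | A.PosSemidef} :=
  fun _ hA _ hB _ _ ha hb _ => (PosSemidef.smul hA ha).add (PosSemidef.smul hB hb)

variable {n : Type*} [Fintype n]

theorem re_trace_nonneg_of_posSemidef {A : Matrix n n ℂ} (hA : A.PosSemidef) : 0 ≤ A.trace.re :=
  (Complex.nonneg_iff.1 hA.trace_nonneg).1

theorem re_trace_eq_zero_iff_of_posSemidef {A : Matrix n n ℂ} (hA : A.PosSemidef) :
    A.trace.re = 0 ↔ A = 0 := by
  rw [← hA.trace_eq_zero_iff, Complex.ext_iff]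
  simp [(Complex.nonneg_iff.1 hA.trace_nonneg).2.symm]

theorem exists_eq_conjTranspose_mul_self_of_posSemidef {A : Matrix n n ℂ} (hA : A.PosSemidef) :
    ∃ B : Matrix n n ℂ, A = Bᴴ * B := by
  classical
  exact CStarAlgebra.nonneg_iff_eq_star_mul_self.1 (Matrix.nonneg_iff_posSemidef.2 hA)

theorem re_trace_mul_nonneg_of_posSemidef {A B : Matrix n n ℂ} (hA : A.PosSemidef)
    (hB : B.PosSemidef) : 0 ≤ (A * B).trace.re := by
  obtain ⟨C, rfl⟩ := exists_eq_conjTranspose_mul_self_of_posSemidef hB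
  rw [← Matrix.mul_assoc, trace_mul_comm, ← Matrix.mul_assoc]
  exact re_trace_nonneg_of_posSemidef (hA.mul_mul_conjTranspose_same C)

theorem mul_eq_zero_of_re_trace_mul_eq_zero {A B : Matrix n n ℂ} (hA : A.PosSemidef)
    (hB : B.PosSemidef) (h : (A * B).trace.re = 0) : A * B = 0 := by
  obtain ⟨C, rfl⟩ := exists_eq_conjTranspose_mul_self_of_posSemidef hB
  obtain ⟨D, rfl⟩ := exists_eq_conjTranspose_mul_self_of_posSemidef hA
  have trace_eq : (Dᴴ * D * (Cᴴ * C)).trace = ((D * Cᴴ)ᴴ * (D * Cᴴ)).trace := by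
    rw [← Matrix.mul_assoc, trace_mul_comm]
    simp only [conjTranspose_mul, conjTranspose_conjTranspose, Matrix.mul_assoc]
  rw [trace_eq, re_trace_eq_zero_iff_of_posSemidef (posSemidef_conjTranspose_mul_self _),
    conjTranspose_mul_self_eq_zero] at h
  rw [Matrix.mul_assoc, ← Matrix.mul_assoc D, h, Matrix.zero_mul, Matrix.mul_zero]

theorem posSemidef_of_re_trace_mul_nonneg {A : Matrix n n ℂ} (hA : A.IsHermitian)
    (h : ∀ B : Matrix n n ℂ, B.PosSemidef → 0 ≤ (A * B).trace.re) : A.PosSemidef := by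
  refine PosSemidef.of_dotProduct_mulVec_nonneg hA fun x => ?_
  have re_nonneg := h _ (posSemidef_vecMulVec_self_star x)
  rw [mul_vecMulVec, trace_vecMulVec, dotProduct_comm] at re_nonneg
  exact Complex.nonneg_iff.2 ⟨re_nonneg, (hA.im_star_dotProduct_mulVec_self x).symm⟩

/- Testing against the ray through `A` gives `re tr (G * A) = 0`, so that `G` is positive
semidefinite by self-duality of the cone. -/
theorem posSemidef_and_mul_eq_zero_of_isMinOn_re_trace_mul {G A : Matrix n n ℂ} (hG : G.IsHermitian)
    (hA : A.PosSemidef)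
    (hmin : IsMinOn (fun B => (G * B).trace.re) {B : Matrix n n ℂ | B.PosSemidef} A) :
    G.PosSemidef ∧ G * A = 0 := by
  have trace_le (B : Matrix n n ℂ) (hB : B.PosSemidef) : (G * A).trace.re ≤ (G * B).trace.re :=
    hmin hB
  have trace_eq_zero : (G * A).trace.re = 0 := by
    have at_zero := trace_le 0 PosSemidef.zero
    have at_double := trace_le (A + A) (hA.add hA)
    simp only [Matrix.mul_zero, Matrix.mul_add, trace_zero, trace_add, Complex.zero_re,
      Complex.add_re] at at_zero at_double
    linarith
  rw [trace_eq_zero] at trace_le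
  have G_posSemidef := posSemidef_of_re_trace_mul_nonneg hG trace_le
  exact ⟨G_posSemidef, mul_eq_zero_of_re_trace_mul_eq_zero G_posSemidef hA trace_eq_zero⟩

variable [DecidableEq n]

theorem posSemidef_norm_smul_one_add {A : Matrix n n ℂ} (hA : A.IsHermitian) :
    (‖A‖ • (1 : Matrix n n ℂ) + A).PosSemidef := by
  have := Matrix.le_iff.1 (IsSelfAdjoint.neg_algebraMap_norm_le_self (a := A) hA)
  rwa [sub_neg_eq_add, Algebra.algebraMap_eq_smul_one, add_comm] at this

theorem abs_eigenvalue_le_norm {A : Matrix n n ℂ} (hA : A.IsHermitian) (i : n) :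
    |hA.eigenvalues i| ≤ ‖A‖ := by
  have : Nonempty n := ⟨i⟩
  exact spectrum.norm_le_norm_of_mem
    (hA.spectrum_real_eq_range_eigenvalues ▸ Set.mem_range_self i)

theorem exists_abs_eigenvalue_sub_eq_norm [Nonempty n] {A : Matrix n n ℂ} (hA : A.IsHermitian)
    (c : ℝ) : ∃ i, |hA.eigenvalues i - c| = ‖A - c • 1‖ := by
  have shift_spectrum := spectrum.sub_singleton_eq A c
  rw [hA.spectrum_real_eq_range_eigenvalues, Algebra.algebraMap_eq_smul_one] at shift_spectrum
  have shift_selfAdjoint : IsSelfAdjoint (A - c • 1) :=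
    IsSelfAdjoint.sub hA ((IsSelfAdjoint.all c).smul (.one _))
  rcases CStarAlgebra.norm_or_neg_norm_mem_spectrum shift_selfAdjoint with h | h <;>
  · rw [← shift_spectrum] at h
    obtain ⟨_, ⟨i, rfl⟩, _, rfl, hi⟩ := h
    exact ⟨i, by simp only [hi, abs_neg, abs_norm]⟩

theorem norm_le_re_trace_of_posSemidef {A : Matrix n n ℂ} (hA : A.PosSemidef) :
    ‖A‖ ≤ A.trace.re := by
  cases isEmpty_or_nonempty n
  · simp [Subsingleton.elim A 0]
  obtain ⟨i, hi⟩ := exists_abs_eigenvalue_sub_eq_norm hA.1 0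
  rw [zero_smul, sub_zero, sub_zero, abs_of_nonneg (hA.eigenvalues_nonneg i)] at hi
  rw [← hi, hA.1.trace_eq_sum_eigenvalues, Complex.re_sum]
  exact Finset.single_le_sum (f := fun j => ((hA.1.eigenvalues j : ℂ)).re)
    (fun j _ => hA.eigenvalues_nonneg j) (Finset.mem_univ i)

theorem isClosed_setOf_posSemidef {n : Type*} [Finite n] :
    IsClosed {A : Matrix n n ℂ | A.PosSemidef} := by
  cases nonempty_fintype n
  classical
  simp only [← Matrix.nonneg_iff_posSemidef]
  exact CStarAlgebra.isClosed_nonneg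

theorem exists_posSemidef_sub_smul_one {n : Type*} [Finite n] [DecidableEq n] {A : Matrix n n ℂ}
    (hA : A.PosDef) : ∃ c : ℝ, 0 < c ∧ (A - c • 1).PosSemidef := by
  cases nonempty_fintype n
  cases isEmpty_or_nonempty n
  · exact ⟨1, one_pos, Subsingleton.elim 0 (A - (1 : ℝ) • 1) ▸ PosSemidef.zero⟩
  obtain ⟨c, hc, hle⟩ := (CFC.exists_pos_algebraMap_le_iff (A := Matrix n n ℂ) (a := A) hA.1).2
    fun x hx => (Matrix.isStrictlyPositive_iff_posDef.2 hA).spectrum_pos hx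
  exact ⟨c, hc, Algebra.algebraMap_eq_smul_one (A := Matrix n n ℂ) c ▸ Matrix.le_iff.1 hle⟩

theorem norm_inv_le_one_of_posSemidef_sub_one {A : Matrix n n ℂ} (hA : (A - 1).PosSemidef) :
    ‖A⁻¹‖ ≤ 1 := by
  have hpos := posDef_of_posSemidef_sub_one hA
  refine (CStarAlgebra.norm_le_one_iff_of_nonneg A⁻¹
    (Matrix.nonneg_iff_posSemidef.2 hpos.inv.posSemidef)).2 ?_
  have inv_le_one := CStarAlgebra.inv_le_one (a := hpos.isUnit.unit) (Matrix.le_iff.2 hA)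
  rwa [Matrix.coe_units_inv] at inv_le_one

theorem norm_inv_sub_inv_le_of_posSemidef_sub_one {A B : Matrix n n ℂ} (hA : (A - 1).PosSemidef)
    (hB : (B - 1).PosSemidef) : ‖A⁻¹ - B⁻¹‖ ≤ ‖A - B‖ := by
  have hAunit := (posDef_of_posSemidef_sub_one hA).isUnit
  have hBunit := (posDef_of_posSemidef_sub_one hB).isUnit
  rw [Matrix.inv_sub_inv (iff_of_true hAunit hBunit), norm_sub_rev A]
  calc ‖A⁻¹ * (B - A) * B⁻¹‖ ≤ ‖A⁻¹‖ * ‖B - A‖ * ‖B⁻¹‖ := norm_mul₃_le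
    _ ≤ 1 * ‖B - A‖ * 1 := by
      gcongr
      exacts [norm_inv_le_one_of_posSemidef_sub_one hA, norm_inv_le_one_of_posSemidef_sub_one hB]
    _ = ‖B - A‖ := by ring

theorem exists_isUnit_eq_conjTranspose_mul_self_of_posDef {A : Matrix n n ℂ} (hA : A.PosDef) :
    ∃ C : Matrix n n ℂ, IsUnit C ∧ A = Cᴴ * C := by
  obtain ⟨C, hAC⟩ := exists_eq_conjTranspose_mul_self_of_posSemidef hA.posSemidef
  refine ⟨C, (isUnit_iff_isUnit_det C).2 (isUnit_of_mul_isUnit_right (x := Cᴴ.det) ?_), hAC⟩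
  rw [← det_mul, ← hAC]
  exact (isUnit_iff_isUnit_det A).1 hA.isUnit

theorem re_det_pos_of_posDef {A : Matrix n n ℂ} (hA : A.PosDef) : 0 < A.det.re :=
  (Complex.pos_iff.1 hA.det_pos).1

theorem log_re_det_eq_sum_log_eigenvalues {A : Matrix n n ℂ} (hA : A.PosDef) :
    Real.log A.det.re = ∑ i, Real.log (hA.1.eigenvalues i) := by
  rw [hA.1.det_eq_prod_eigenvalues, ← Real.log_prod fun i _ => (hA.eigenvalues_pos i).ne']
  norm_cast

theorem log_re_det_smul {A : Matrix n n ℂ} (hA : A.PosDef) {c : ℝ} (hc : 0 < c) :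
    Real.log (c • A).det.re = Fintype.card n * Real.log c + Real.log A.det.re := by
  have det_eq : (c • A).det.re = c ^ Fintype.card n * A.det.re := by
    rw [← Complex.coe_smul, det_smul, ← Complex.ofReal_pow, Complex.re_ofReal_mul]
  rw [det_eq, Real.log_mul (by positivity) (re_det_pos_of_posDef hA).ne', Real.log_pow]

end Matrices

section LogDetDivergence

open Matrix
open scoped Matrix.Norms.L2Operator

theorem log_le_sub_one_sub_sq_div {x : ℝ} (hx : 0 < x) :
    Real.log x ≤ x - 1 - (x - 1) ^ 2 / (2 * (x + 1)) := by
  obtain ⟨y, hy, rfl⟩ : ∃ y : ℝ, 0 < y ∧ x = y ^ 2 :=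
    ⟨√x, Real.sqrt_pos.2 hx, (Real.sq_sqrt hx.le).symm⟩
  have log_le := Real.log_le_sub_one_of_pos hy
  have quotient_le : (y ^ 2 - 1) ^ 2 / (2 * (y ^ 2 + 1)) ≤ (y - 1) ^ 2 := by
    rw [div_le_iff₀ (by positivity)]
    nlinarith [sq_nonneg ((y - 1) ^ 2)]
  rw [Real.log_pow]
  push_cast
  linarith

variable {n : Type*} [Fintype n] [DecidableEq n]

/-- The Bregman divergence of the convex function `-log det` on positive definite matrices (Stein's
loss): the gap at `B` between `log det` and its tangent at `A`. -/
noncomputable def logDetDivergence (A B : Matrix n n ℂ) : ℝ :=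
  Real.log A.det.re + (A⁻¹ * (B - A)).trace.re - Real.log B.det.re

theorem logDetDivergence_self (A : Matrix n n ℂ) : logDetDivergence A A = 0 := by
  rw [logDetDivergence, sub_self, Matrix.mul_zero, trace_zero, Complex.zero_re, add_zero, sub_self]

theorem logDetDivergence_conjTranspose_mul_mul {A B C : Matrix n n ℂ} (hA : A.PosDef)
    (hB : B.PosDef) (hC : IsUnit C) :
    logDetDivergence (Cᴴ * A * C) (Cᴴ * B * C) = logDetDivergence A B := by
  have hC' := (isUnit_iff_isUnit_det C).1 hC
  have hCH : IsUnit Cᴴ.det := det_conjTranspose C ▸ hC'.star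
  have log_det (X : Matrix n n ℂ) (hX : X.PosDef) : Real.log (Cᴴ * X * C).det.re =
      Real.log (Complex.normSq C.det) + Real.log X.det.re := by
    rw [← Real.log_mul (Complex.normSq_pos.2 hC'.ne_zero).ne' (re_det_pos_of_posDef hX).ne',
      ← Complex.re_ofReal_mul, Complex.normSq_eq_conj_mul_self, det_mul, det_mul, det_conjTranspose,
      Complex.star_def, mul_right_comm]
  have trace_eq : ((Cᴴ * A * C)⁻¹ * (Cᴴ * B * C - Cᴴ * A * C)).trace =
      (A⁻¹ * (B - A)).trace := by
    rw [← Matrix.sub_mul, ← Matrix.mul_sub, Matrix.mul_inv_rev, Matrix.mul_inv_rev, trace_mul_comm]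
    simp only [Matrix.mul_assoc]
    rw [Matrix.mul_nonsing_inv_cancel_left _ _ hC', trace_mul_comm]
    simp only [Matrix.mul_assoc]
    rw [Matrix.nonsing_inv_mul _ hCH, Matrix.mul_one, trace_mul_comm]
  rw [logDetDivergence, logDetDivergence, log_det A hA, log_det B hB, trace_eq]
  ring

theorem sq_norm_sub_one_le_logDetDivergence {A : Matrix n n ℂ} (hA : A.PosDef) :
    ‖A - 1‖ ^ 2 ≤ 2 * (‖A‖ + 1) * logDetDivergence 1 A := by
  cases isEmpty_or_nonempty n
  · simp [logDetDivergence, Subsingleton.elim (A - 1) 0, Matrix.det_isEmpty]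
  set ev := hA.1.eigenvalues with ev_def
  have ev_pos : ∀ i, 0 < ev i := hA.eigenvalues_pos
  have divergence_eq : logDetDivergence 1 A = ∑ i, (ev i - 1 - Real.log (ev i)) := by
    rw [logDetDivergence, log_re_det_eq_sum_log_eigenvalues hA, inv_one, Matrix.one_mul, trace_sub,
      hA.1.trace_eq_sum_eigenvalues]
    simp [Finset.sum_sub_distrib, ev_def]
  have summand_ge (i : n) : (ev i - 1) ^ 2 / (2 * (ev i + 1)) ≤ ev i - 1 - Real.log (ev i) := by
    linarith [log_le_sub_one_sub_sq_div (ev_pos i)]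
  obtain ⟨j, norm_eq⟩ := exists_abs_eigenvalue_sub_eq_norm hA.1 1
  rw [one_smul] at norm_eq
  have ev_le : ev j ≤ ‖A‖ := (le_abs_self _).trans (abs_eigenvalue_le_norm hA.1 j)
  have := ev_pos j
  rw [← norm_eq, sq_abs, ← div_le_iff₀' (by positivity), divergence_eq]
  calc (ev j - 1) ^ 2 / (2 * (‖A‖ + 1)) ≤ (ev j - 1) ^ 2 / (2 * (ev j + 1)) := by gcongr
    _ ≤ ev j - 1 - Real.log (ev j) := summand_ge j
    _ ≤ ∑ i, (ev i - 1 - Real.log (ev i)) :=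
      Finset.single_le_sum (f := fun i => ev i - 1 - Real.log (ev i))
        (fun i _ => sub_nonneg.2 (Real.log_le_sub_one_of_pos (ev_pos i))) (Finset.mem_univ j)

/- Congruence by the inverse of a square root of `A` reduces to the case `A = 1`. -/
theorem sq_norm_sub_le_logDetDivergence {A B : Matrix n n ℂ} (hA : A.PosDef) (hB : B.PosDef) :
    ‖B - A‖ ^ 2 ≤ 2 * ‖A‖ ^ 2 * (‖A⁻¹‖ * ‖B‖ + 1) * logDetDivergence A B := by
  obtain ⟨C, hC, hAC⟩ := exists_isUnit_eq_conjTranspose_mul_self_of_posDef hA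
  have hCH : IsUnit Cᴴ := hC.star
  set T := C⁻¹ᴴ * B * C⁻¹ with hT
  have hTpos : T.PosDef := hB.conjTranspose_mul_mul_same
    (mulVec_injective_of_isUnit (isUnit_nonsing_inv_iff.2 hC))
  have hBT : B = Cᴴ * T * C := by
    rw [hT, conjTranspose_nonsing_inv, ← Matrix.mul_assoc, ← Matrix.mul_assoc,
      Matrix.mul_nonsing_inv _ ((isUnit_iff_isUnit_det _).1 hCH), Matrix.one_mul, Matrix.mul_assoc,
      Matrix.nonsing_inv_mul _ ((isUnit_iff_isUnit_det _).1 hC), Matrix.mul_one]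
  have divergence_eq : logDetDivergence A B = logDetDivergence 1 T := by
    rw [← logDetDivergence_conjTranspose_mul_mul PosDef.one hTpos hC, ← hBT, Matrix.mul_one, ← hAC]
  have sub_eq : B - A = Cᴴ * (T - 1) * C := by
    rw [Matrix.mul_sub, Matrix.sub_mul, ← hBT, Matrix.mul_one, ← hAC]
  have sq_norm_C : ‖C‖ * ‖C‖ = ‖A‖ := by rw [hAC, l2_opNorm_conjTranspose_mul_self]
  have sq_norm_inv_C : ‖C⁻¹‖ * ‖C⁻¹‖ = ‖A⁻¹‖ := by
    rw [← l2_opNorm_conjTranspose C⁻¹, ← l2_opNorm_conjTranspose_mul_self,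
      conjTranspose_conjTranspose, conjTranspose_nonsing_inv, ← Matrix.mul_inv_rev, ← hAC]
  have norm_sub_le : ‖B - A‖ ≤ ‖A‖ * ‖T - 1‖ := by
    rw [sub_eq, ← sq_norm_C, mul_right_comm, ← l2_opNorm_conjTranspose C]
    exact norm_mul₃_le.trans_eq (by rw [l2_opNorm_conjTranspose])
  have norm_T_le : ‖T‖ ≤ ‖A⁻¹‖ * ‖B‖ := by
    rw [← sq_norm_inv_C, mul_right_comm]
    exact norm_mul₃_le.trans_eq (by rw [l2_opNorm_conjTranspose])
  have divergence_nonneg : 0 ≤ logDetDivergence 1 T :=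
    nonneg_of_mul_nonneg_right
      ((sq_nonneg _).trans (sq_norm_sub_one_le_logDetDivergence hTpos)) (by positivity)
  calc ‖B - A‖ ^ 2 ≤ (‖A‖ * ‖T - 1‖) ^ 2 := by gcongr
    _ = ‖A‖ ^ 2 * ‖T - 1‖ ^ 2 := mul_pow _ _ _
    _ ≤ ‖A‖ ^ 2 * (2 * (‖T‖ + 1) * logDetDivergence 1 T) := by
      gcongr
      exact sq_norm_sub_one_le_logDetDivergence hTpos
    _ ≤ ‖A‖ ^ 2 * (2 * (‖A⁻¹‖ * ‖B‖ + 1) * logDetDivergence 1 T) := by gcongr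
    _ = 2 * ‖A‖ ^ 2 * (‖A⁻¹‖ * ‖B‖ + 1) * logDetDivergence A B := by
      rw [divergence_eq]
      ring

theorem logDetDivergence_pos {A B : Matrix n n ℂ} (hA : A.PosDef) (hB : B.PosDef) (h : A ≠ B) :
    0 < logDetDivergence A B :=
  pos_of_mul_pos_right
    ((pow_pos (norm_pos_iff.2 (sub_ne_zero.2 h.symm)) 2).trans_le
      (sq_norm_sub_le_logDetDivergence hA hB)) (by positivity)

theorem logDetDivergence_nonneg {A B : Matrix n n ℂ} (hA : A.PosDef) (hB : B.PosDef) :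
    0 ≤ logDetDivergence A B := by
  obtain rfl | h := eq_or_ne A B
  · exact (logDetDivergence_self A).ge
  · exact (logDetDivergence_pos hA hB h).le

end LogDetDivergence

/-! ### Hölder error bounds for linear systems over convex sets -/

section HolderErrorBound

variable {E E' F : Type*} [NormedAddCommGroup E] [NormedSpace ℝ E] [NormedAddCommGroup E']
  [NormedSpace ℝ E'] [NormedAddCommGroup F] [NormedSpace ℝ F]

/-- A local Hölder error bound for the linear system `L x = y`, `x ∈ K`: on every ball, the distance
from a point of `K` to the solution set is at most a constant times a power of the residual. The
nearby solution is named explicitly, so that the bound also asserts solvability. -/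
def HolderErrorBound (K : Set E) (L : E →L[ℝ] F) (y : F) : Prop :=
  ∀ R : ℝ, ∃ C γ : ℝ, 0 ≤ C ∧ 0 < γ ∧ γ ≤ 1 ∧ ∀ x ∈ K, ‖x‖ ≤ R →
    ∃ x' ∈ K, L x' = y ∧ ‖x - x'‖ ≤ C * ‖L x - y‖ ^ γ

theorem rpow_le_rpow_sub_mul_rpow {r ρ s t : ℝ} (hr : 0 ≤ r) (hrρ : r ≤ ρ) (hs : 0 ≤ s)
    (hst : s ≤ t) : r ^ t ≤ ρ ^ (t - s) * r ^ s := by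
  calc r ^ t = r ^ (t - s) * r ^ s := by
        rw [← Real.rpow_add_of_nonneg hr (sub_nonneg.2 hst) hs, sub_add_cancel]
    _ ≤ ρ ^ (t - s) * r ^ s := by
      gcongr

/- The exponent is halved: the residual of `J (P x)` is only of the order of the square root of the
residual of `x`. -/
theorem HolderErrorBound.of_approx_retract {K : Set E} {K' : Set E'} {L : E →L[ℝ] F} {y : F}
    (J : E' →L[ℝ] E) (P : E →L[ℝ] E') (hJ : Set.MapsTo J K' K) (hP : Set.MapsTo P K K')
    (hJP : ∀ R : ℝ, ∃ B : ℝ, ∀ x ∈ K, ‖x‖ ≤ R → ‖x - J (P x)‖ ≤ B * √‖L x - y‖)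
    (h : HolderErrorBound K' (L.comp J) y) : HolderErrorBound K L y := by
  intro R
  obtain ⟨B, hB⟩ := hJP R
  obtain ⟨C, γ, hC, hγ, hγ1, herr⟩ := h (‖P‖ * R)
  set ρ := |‖L‖ * R + ‖y‖|
  set a := √ρ + ‖L‖ * |B|
  refine ⟨|B| * ρ ^ (1 / 2 - γ / 2) + ‖J‖ * C * a ^ γ, γ / 2, by positivity, by positivity,
    by linarith, fun x hx hxR => ?_⟩
  set r := ‖L x - y‖
  have hrρ : r ≤ ρ := calc
    ‖L x - y‖ ≤ ‖L‖ * ‖x‖ + ‖y‖ := (norm_sub_le _ _).trans (by gcongr; exact L.le_opNorm x)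
    _ ≤ ‖L‖ * R + ‖y‖ := by gcongr
    _ ≤ ρ := le_abs_self _
  have dist_retract : ‖x - J (P x)‖ ≤ |B| * √r :=
    (hB x hx hxR).trans (by gcongr; exact le_abs_self B)
  have residual_retract : ‖L.comp J (P x) - y‖ ≤ a * √r := calc
    ‖L (J (P x)) - y‖ = ‖(L x - y) - L (x - J (P x))‖ := by rw [map_sub]; abel_nf
    _ ≤ r + ‖L‖ * ‖x - J (P x)‖ := (norm_sub_le _ _).trans (by gcongr; exact L.le_opNorm _)
    _ ≤ √ρ * √r + ‖L‖ * (|B| * √r) := by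
      gcongr
      exact (Real.mul_self_sqrt (norm_nonneg _)).symm.le.trans (by gcongr)
    _ = a * √r := by ring
  obtain ⟨z, hz, hLz, hdist⟩ := herr (P x) (hP hx)
    ((P.le_opNorm x).trans (by gcongr))
  refine ⟨J z, hJ hz, hLz, ?_⟩
  have sqrt_le : √r ≤ ρ ^ (1 / 2 - γ / 2) * r ^ (γ / 2) := by
    rw [Real.sqrt_eq_rpow]
    exact rpow_le_rpow_sub_mul_rpow (norm_nonneg _) hrρ (by positivity) (by linarith)
  calc ‖x - J z‖ = ‖(x - J (P x)) + J (P x - z)‖ := by rw [map_sub]; abel_nf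
    _ ≤ |B| * √r + ‖J‖ * (C * (a * √r) ^ γ) := by
      refine (norm_add_le _ _).trans (add_le_add dist_retract ((J.le_opNorm _).trans ?_))
      gcongr
      exact hdist.trans (by gcongr)
    _ = |B| * √r + ‖J‖ * C * a ^ γ * r ^ (γ / 2) := by
      rw [Real.mul_rpow (by positivity) (by positivity), Real.sqrt_eq_rpow r,
        ← Real.rpow_mul (norm_nonneg _), one_div_mul_eq_div]
      ring
    _ ≤ |B| * (ρ ^ (1 / 2 - γ / 2) * r ^ (γ / 2)) + ‖J‖ * C * a ^ γ * r ^ (γ / 2) := by gcongr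
    _ = (|B| * ρ ^ (1 / 2 - γ / 2) + ‖J‖ * C * a ^ γ) * r ^ (γ / 2) := by ring

theorem HolderErrorBound.of_retract {K : Set E} {K' : Set E'} {L : E →L[ℝ] F} {y : F}
    (J : E' →L[ℝ] E) (P : E →L[ℝ] E') (hJ : Set.MapsTo J K' K) (hP : Set.MapsTo P K K')
    (hJP : ∀ x ∈ K, J (P x) = x) (h : HolderErrorBound K' (L.comp J) y) :
    HolderErrorBound K L y :=
  h.of_approx_retract J P hJ hP fun _ => ⟨0, fun x hx _ => by simp [hJP x hx]⟩

theorem exists_combination_mem_of_closedBall_subset {K : Set E} (hK : Convex ℝ K)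
    {x x₁ : E} {ε : ℝ} (hε : 0 < ε) (hball : Metric.closedBall x₁ ε ⊆ K) (hx : x ∈ K)
    (d : E) :
    ∃ t, 0 ≤ t ∧ t ≤ 1 ∧ t ≤ ‖d‖ / ε ∧ (1 - t) • (x + d) + t • x₁ ∈ K := by
  obtain rfl | hd := eq_or_ne d 0
  · exact ⟨0, le_rfl, zero_le_one, by simp, by simpa using hx⟩
  have hd : 0 < ‖d‖ := norm_pos_iff.2 hd
  set t := ‖d‖ / (‖d‖ + ε) with ht
  have one_sub_t : 1 - t = ε / (‖d‖ + ε) := by rw [ht]; field_simp; ring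
  have mem_ball : x₁ + (ε / ‖d‖) • d ∈ K := hball <| by
    rw [mem_closedBall_iff_norm, add_sub_cancel_left, norm_smul,
      Real.norm_of_nonneg (by positivity), div_mul_cancel₀ _ hd.ne']
  have combination_eq : (1 - t) • (x + d) + t • x₁ =
      (1 - t) • x + t • (x₁ + (ε / ‖d‖) • d) := by
    have : t * (ε / ‖d‖) = 1 - t := by rw [one_sub_t, ht]; field_simp
    rw [smul_add t, smul_smul, this, smul_add]
    abel
  refine ⟨t, by positivity, ?_, ?_, ?_⟩
  · exact div_le_one_of_le₀ (by linarith) (by positivity)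
  · exact div_le_div_of_nonneg_left hd.le hε (by linarith)
  · rw [combination_eq]
    exact hK hx mem_ball (by rw [one_sub_t]; positivity) (by positivity) (by ring)

section FiniteDimensional

variable [FiniteDimensional ℝ E]

theorem HolderErrorBound.of_submodule {K : Set E} {L : E →L[ℝ] F} {y : F} (V : Submodule ℝ E)
    (hK : K ⊆ V) (h : HolderErrorBound (V.subtypeL ⁻¹' K) (L.comp V.subtypeL) y) :
    HolderErrorBound K L y := by
  obtain ⟨P, hP⟩ := V.subtype.exists_leftInverse_of_injective V.ker_subtype
  have hPV (x : E) (hx : x ∈ K) : (P x : E) = x :=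
    congr_arg Subtype.val (LinearMap.congr_fun hP ⟨x, hK hx⟩)
  refine h.of_retract V.subtypeL (LinearMap.toContinuousLinearMap P) (Set.mapsTo_preimage _ _)
    (fun x hx => ?_) hPV
  change (P x : E) ∈ K
  exact (hPV x hx).symm ▸ hx

theorem exists_preimage_of_range_norm_le (L : E →L[ℝ] F) :
    ∃ C > 0, ∀ x, ∃ x', L x' = L x ∧ ‖x'‖ ≤ C * ‖L x‖ := by
  have : CompleteSpace L.range := FiniteDimensional.complete ℝ _
  have : CompleteSpace E := FiniteDimensional.complete ℝ E
  obtain ⟨C, hC, h⟩ :=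
    L.rangeRestrict.exists_preimage_norm_le L.toLinearMap.surjective_rangeRestrict
  refine ⟨C, hC, fun x => ?_⟩
  obtain ⟨x', hx', hnorm⟩ := h (L.rangeRestrict x)
  exact ⟨x', congr_arg Subtype.val hx', hnorm⟩

/- Correct `x` to an exact solution `x + d` of the system, which may leave `K`, and then move
towards the interior solution just far enough to return to `K`. -/
theorem holderErrorBound_of_mem_interior {K : Set E} (hK : Convex ℝ K) (L : E →L[ℝ] F) {x₁ : E}
    (hx₁ : x₁ ∈ interior K) : HolderErrorBound K L (L x₁) := by
  intro R
  obtain ⟨ε, hε, hball⟩ := Metric.nhds_basis_closedBall.mem_iff.1 (mem_interior_iff_mem_nhds.1 hx₁)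
  obtain ⟨c, hc, preimage⟩ := exists_preimage_of_range_norm_le L
  refine ⟨((|R| + ‖x₁‖) / ε + 1) * c, 1, by positivity, one_pos, le_rfl, fun x hx hxR => ?_⟩
  obtain ⟨d, hLd, hd⟩ := preimage (x₁ - x)
  rw [map_sub, norm_sub_rev] at hd
  rw [map_sub] at hLd
  obtain ⟨t, ht0, ht1, htd, hmem⟩ := exists_combination_mem_of_closedBall_subset hK hε hball hx d
  refine ⟨_, hmem, ?_, ?_⟩
  · rw [map_add, map_smul, map_smul, map_add, hLd, add_sub_cancel, ← add_smul, sub_add_cancel,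
      one_smul]
  have sub_eq : x - ((1 - t) • (x + d) + t • x₁) = t • (x - x₁) - (1 - t) • d := by module
  have norm_sub_le' : ‖x - x₁‖ ≤ |R| + ‖x₁‖ :=
    (norm_sub_le _ _).trans (by gcongr; exact hxR.trans (le_abs_self R))
  rw [sub_eq, Real.rpow_one]
  calc ‖t • (x - x₁) - (1 - t) • d‖ ≤ ‖t • (x - x₁)‖ + ‖(1 - t) • d‖ := norm_sub_le _ _
    _ = t * ‖x - x₁‖ + (1 - t) * ‖d‖ := by
      rw [norm_smul, norm_smul, Real.norm_of_nonneg ht0, Real.norm_of_nonneg (sub_nonneg.2 ht1)]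
    _ ≤ ‖d‖ / ε * (|R| + ‖x₁‖) + 1 * ‖d‖ := by
      gcongr
      linarith
    _ = ((|R| + ‖x₁‖) / ε + 1) * ‖d‖ := by ring
    _ ≤ ((|R| + ‖x₁‖) / ε + 1) * (c * ‖L x - L x₁‖) := by gcongr
    _ = ((|R| + ‖x₁‖) / ε + 1) * c * ‖L x - L x₁‖ := by ring

theorem exists_separating_functional_of_forall_mem_interior {K : Set E} (hK : Convex ℝ K)
    (L : E →L[ℝ] F) {x₀ x₁ : E} (hx₁ : x₁ ∈ interior K)
    (h : ∀ x ∈ interior K, L x ≠ L x₀) :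
    ∃ f : F →L[ℝ] ℝ, (∀ x ∈ K, f (L x₀) ≤ f (L x)) ∧ f (L x₀) < f (L x₁) := by
  have : CompleteSpace L.range := FiniteDimensional.complete ℝ _
  have : CompleteSpace E := FiniteDimensional.complete ℝ E
  have himage_open : IsOpen (L.rangeRestrict '' interior K) :=
    L.rangeRestrict.isOpenMap L.toLinearMap.surjective_rangeRestrict _ isOpen_interior
  have himage_convex : Convex ℝ (L.rangeRestrict '' interior K) :=
    hK.interior.linear_image L.rangeRestrict.toLinearMap
  have hnotMem : L.rangeRestrict x₀ ∉ L.rangeRestrict '' interior K := by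
    rintro ⟨x, hx, hLx⟩
    exact h x hx (congr_arg Subtype.val hLx)
  obtain ⟨g, hg⟩ := geometric_hahn_banach_point_open himage_convex himage_open hnotMem
  obtain ⟨f, hf, -⟩ := exists_extension_norm_eq L.range g
  have hfL (x : E) : f (L x) = g (L.rangeRestrict x) := hf (L.rangeRestrict x)
  have hlt (x : E) (hx : x ∈ interior K) : f (L x₀) < f (L x) := by
    rw [hfL, hfL]
    exact hg _ (Set.mem_image_of_mem _ hx)
  refine ⟨f, fun x hx => ?_, hlt x₁ hx₁⟩
  have hclosed : IsClosed {x | f (L x₀) ≤ f (L x)} := by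
    exact isClosed_le continuous_const (f.comp L).continuous
  have hsubset : closure (interior K) ⊆ {x | f (L x₀) ≤ f (L x)} :=
    closure_minimal (fun x hx => (hlt x hx).le) hclosed
  exact hsubset ((hK.closure_interior_eq_closure_of_nonempty_interior ⟨x₁, hx₁⟩).symm ▸
    subset_closure hx)

end FiniteDimensional

end HolderErrorBound

/-! ### Error bounds over the positive semidefinite cone -/

section Congruence

open Matrix
open scoped Matrix.Norms.L2Operator

variable {m n : Type*} [Fintype n]

/-- The real linear map `X ↦ V X Vᴴ` between spaces of square matrices, continuous because these
are finite-dimensional. -/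
noncomputable def congruence (V : Matrix m n ℂ) : Matrix n n ℂ →L[ℝ] Matrix m m ℂ :=
  LinearMap.toContinuousLinearMap
    { toFun := fun X => V * X * Vᴴ
      map_add' := fun X Y => by rw [Matrix.mul_add, Matrix.add_mul]
      map_smul' := fun c X => by
        rw [Matrix.mul_smul, Matrix.smul_mul, RingHom.id_apply] }

theorem congruence_apply (V : Matrix m n ℂ) (X : Matrix n n ℂ) :
    congruence V X = V * X * Vᴴ :=
  rfl

theorem posSemidef_congruence [Finite m] (V : Matrix m n ℂ) {X : Matrix n n ℂ} (hX : X.PosSemidef) :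
    (congruence V X).PosSemidef :=
  hX.mul_mul_conjTranspose_same V

end Congruence

section FacialReduction

open Matrix
open scoped Matrix.Norms.L2Operator MatrixOrder

universe u

variable {n : Type u} [Fintype n] {F : Type*} [NormedAddCommGroup F] [NormedSpace ℝ F]

theorem exists_isHermitian_re_trace_mul_eq
    (ψ : selfAdjoint.submodule ℝ (Matrix n n ℂ) →ₗ[ℝ] ℝ) :
    ∃ G : Matrix n n ℂ, G.IsHermitian ∧ ∀ X, (G * X).trace.re = ψ X := by
  classical
  let traceForm : selfAdjoint.submodule ℝ (Matrix n n ℂ) →ₗ[ℝ]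
      Module.Dual ℝ (selfAdjoint.submodule ℝ (Matrix n n ℂ)) :=
    LinearMap.mk₂ ℝ (fun G X => (G * X : Matrix n n ℂ).trace.re)
      (fun _ _ _ => by simp [Matrix.add_mul]) (fun _ _ _ => by simp)
      (fun _ _ _ => by simp [Matrix.mul_add]) (fun _ _ _ => by simp)
  have traceForm_injective : Function.Injective traceForm := by
    rw [injective_iff_map_eq_zero]
    intro G hG
    have re_trace_eq_zero : ((G : Matrix n n ℂ)ᴴ * G).trace.re = 0 := by
      rw [(show (G : Matrix n n ℂ).IsHermitian from G.2).eq]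
      exact LinearMap.congr_fun hG G
    rw [re_trace_eq_zero_iff_of_posSemidef (posSemidef_conjTranspose_mul_self _),
      conjTranspose_mul_self_eq_zero] at re_trace_eq_zero
    exact Subtype.ext re_trace_eq_zero
  obtain ⟨G, hG⟩ := (LinearMap.injective_iff_surjective_of_finrank_eq_finrank
    Subspace.dual_finrank_eq.symm).1 traceForm_injective ψ
  exact ⟨G, G.2, fun X => LinearMap.congr_fun hG X⟩

theorem mem_interior_posSemidef_iff_posDef {n : Type*} [Finite n]
    (A : selfAdjoint.submodule ℝ (Matrix n n ℂ)) :
    A ∈ interior ((selfAdjoint.submodule ℝ (Matrix n n ℂ)).subtypeL ⁻¹' {X | X.PosSemidef}) ↔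
      (A : Matrix n n ℂ).PosDef := by
  cases nonempty_fintype n
  classical
  rw [mem_interior_iff_mem_nhds]
  constructor
  · intro hA
    let one : selfAdjoint.submodule ℝ (Matrix n n ℂ) := ⟨1, .one _⟩
    have path_tendsto : Tendsto (fun t : ℝ => A - t • one) (𝓝[>] 0) (𝓝 A) :=
      tendsto_nhdsWithin_of_tendsto_nhds
        (Continuous.tendsto' (by fun_prop) _ _ (by rw [zero_smul, sub_zero]))
    obtain ⟨t, hmem, ht⟩ := ((path_tendsto.eventually hA).and self_mem_nhdsWithin).exists
    have := PosDef.posSemidef_add hmem (PosDef.one.smul (show 0 < t from ht))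
    exact sub_add_cancel (A : Matrix n n ℂ) (t • 1) ▸ this
  · intro hA
    obtain ⟨c, hc, hAc⟩ := exists_posSemidef_sub_smul_one hA
    refine Metric.mem_nhds_iff.2 ⟨c, hc, fun X hX => ?_⟩
    set D := (X - A : Matrix n n ℂ) with hD
    have hDc : ‖D‖ < c := mem_ball_iff_norm.1 hX
    have hDherm : D.IsHermitian := IsSelfAdjoint.sub X.2 A.2
    have decomposition : (X : Matrix n n ℂ) =
        (A - c • 1) + (‖D‖ • (1 : Matrix n n ℂ) + D) + (c - ‖D‖) • (1 : Matrix n n ℂ) := by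
      rw [hD, sub_smul]
      abel
    change (X : Matrix n n ℂ).PosSemidef
    rw [decomposition]
    exact (hAc.add (posSemidef_norm_smul_one_add hDherm)).add
      (PosSemidef.one.smul (sub_nonneg.2 hDc.le))

theorem exists_posSemidef_annihilator (L : Matrix n n ℂ →L[ℝ] F) {A₀ : Matrix n n ℂ}
    (hA₀ : A₀.PosSemidef) (h : ∀ A : Matrix n n ℂ, A.PosDef → L A ≠ L A₀) :
    ∃ (f : F →L[ℝ] ℝ) (G : Matrix n n ℂ), G.PosSemidef ∧ G ≠ 0 ∧ f (L A₀) = 0 ∧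
      ∀ A : Matrix n n ℂ, A.IsHermitian → (G * A).trace.re = f (L A) := by
  classical
  let V := selfAdjoint.submodule ℝ (Matrix n n ℂ)
  have cone_convex : Convex ℝ (V.subtypeL ⁻¹' {X | X.PosSemidef}) :=
    convex_setOf_posSemidef.linear_preimage V.subtype
  obtain ⟨f, hf, hlt⟩ := exists_separating_functional_of_forall_mem_interior cone_convex
    (L.comp V.subtypeL) (x₀ := ⟨A₀, hA₀.1⟩) (x₁ := ⟨1, .one _⟩)
    ((mem_interior_posSemidef_iff_posDef _).2 PosDef.one)
    fun A hA => h A ((mem_interior_posSemidef_iff_posDef A).1 hA)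
  obtain ⟨G, hG, trace_eq⟩ :=
    exists_isHermitian_re_trace_mul_eq (f.comp (L.comp V.subtypeL)).toLinearMap
  have trace_eq' (A : Matrix n n ℂ) (hA : A.IsHermitian) : (G * A).trace.re = f (L A) :=
    trace_eq ⟨A, hA⟩
  have A₀_isMinOn : IsMinOn (fun A => (G * A).trace.re) {A : Matrix n n ℂ | A.PosSemidef} A₀ := by
    intro A hA
    have hA : A.PosSemidef := hA
    change (G * A₀).trace.re ≤ (G * A).trace.re
    rw [trace_eq' A₀ hA₀.1, trace_eq' A hA.1]
    exact hf ⟨A, hA.1⟩ hA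
  obtain ⟨G_posSemidef, GA₀_eq⟩ :=
    posSemidef_and_mul_eq_zero_of_isMinOn_re_trace_mul hG hA₀ A₀_isMinOn
  have f_eq_zero : f (L A₀) = 0 := by
    rw [← trace_eq' A₀ hA₀.1, GA₀_eq, trace_zero, Complex.zero_re]
  refine ⟨f, G, G_posSemidef, ?_, f_eq_zero, trace_eq'⟩
  rintro rfl
  have f_pos : 0 < f (L 1) := f_eq_zero ▸ hlt
  rw [← trace_eq' 1 isHermitian_one, Matrix.zero_mul, trace_zero, Complex.zero_re] at f_pos
  exact f_pos.false

theorem submatrix_mul_conjTranspose_eq_mul_diagonal {m n : Type*} [Fintype n] [DecidableEq n]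
    (U : Matrix m n ℂ) (p : n → Prop) [DecidablePred p] :
    U.submatrix id (Subtype.val : {i // p i} → n) *
        (U.submatrix id (Subtype.val : {i // p i} → n))ᴴ =
      U * diagonal (fun i => (if p i then 1 else 0 : ℂ)) * Uᴴ := by
  ext a b
  rw [Matrix.mul_apply, Matrix.mul_apply]
  simp only [mul_diagonal, conjTranspose_apply, submatrix_apply, id]
  rw [← Finset.sum_subtype (Finset.univ.filter p) (by simp) (fun i => U a i * star (U b i)),
    Finset.sum_filter]
  exact Finset.sum_congr rfl fun i _ => by split_ifs <;> simp

variable [DecidableEq n]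

theorem sub_smul_one_sub_eq_mul_diagonal_mul_conjTranspose {U : Matrix n n ℂ} (hU : U * Uᴴ = 1)
    (a b : n → ℝ) (c : ℝ) :
    U * diagonal (fun i => (a i : ℂ)) * Uᴴ - c • (1 - U * diagonal (fun i => (b i : ℂ)) * Uᴴ) =
      U * diagonal (fun i => ((a i - c * (1 - b i) : ℝ) : ℂ)) * Uᴴ := by
  have diagonal_eq : diagonal (fun i => ((a i - c * (1 - b i) : ℝ) : ℂ)) =
      diagonal (fun i => (a i : ℂ)) - c • (1 - diagonal (fun i => (b i : ℂ))) := by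
    rw [← diagonal_one, diagonal_sub, ← diagonal_smul, diagonal_sub]
    congr 1
    ext i
    simp
  rw [diagonal_eq, Matrix.mul_sub, Matrix.sub_mul, Matrix.mul_smul, Matrix.smul_mul,
    Matrix.mul_sub, Matrix.sub_mul, Matrix.mul_one, hU]

/- The columns of `V` are the eigenvectors of `G` in its kernel, and `δ` is the smallest nonzero
eigenvalue. -/
theorem exists_isometry_posSemidef_sub_smul {G : Matrix n n ℂ} (hG : G.PosSemidef) (hG0 : G ≠ 0) :
    ∃ (ι : Type u) (_ : Fintype ι) (_ : DecidableEq ι) (V : Matrix n ι ℂ) (δ : ℝ),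
      Fintype.card ι < Fintype.card n ∧ 0 < δ ∧ Vᴴ * V = 1 ∧
        (G - δ • (1 - V * Vᴴ)).PosSemidef := by
  classical
  set d := hG.1.eigenvalues
  set U : Matrix n n ℂ := (hG.1.eigenvectorUnitary : Matrix n n ℂ)
  have hUU : U * Uᴴ = 1 := Unitary.coe_mul_star_self hG.1.eigenvectorUnitary
  have hUU' : Uᴴ * U = 1 := Unitary.coe_star_mul_self hG.1.eigenvectorUnitary
  have spectral : G = U * diagonal (fun i => (d i : ℂ)) * Uᴴ := by
    have := hG.1.spectral_theorem
    rwa [Unitary.conjStarAlgAut_apply] at this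
  obtain ⟨j, hj⟩ : ∃ j, d j ≠ 0 := by
    by_contra! hzero
    exact hG0 (hG.1.eigenvalues_eq_zero_iff.1 (funext hzero))
  obtain ⟨k, hk, hmin⟩ := Finset.exists_min_image (Finset.univ.filter fun i => d i ≠ 0) d
    ⟨j, by simpa using hj⟩
  simp only [Finset.mem_filter, Finset.mem_univ, true_and] at hk hmin
  have hδ : 0 < d k := (hG.eigenvalues_nonneg k).lt_of_ne' hk
  set V : Matrix n {i // d i = 0} ℂ := U.submatrix id Subtype.val with hV
  have V_mul : V * Vᴴ = U * diagonal (fun i => (if d i = 0 then 1 else 0 : ℂ)) * Uᴴ :=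
    submatrix_mul_conjTranspose_eq_mul_diagonal U fun i => d i = 0
  have mul_V : Vᴴ * V = 1 := by
    rw [hV, conjTranspose_submatrix, ← submatrix_mul Uᴴ U _ id _ Function.bijective_id, hUU',
      submatrix_one _ Subtype.val_injective]
  have diagonalization : G - d k • (1 - V * Vᴴ) =
      U * diagonal (fun i => ((d i - d k * (1 - if d i = 0 then 1 else 0) : ℝ) : ℂ)) * Uᴴ := by
    rw [← sub_smul_one_sub_eq_mul_diagonal_mul_conjTranspose hUU, ← spectral, V_mul]
    simp only [apply_ite Complex.ofReal, Complex.ofReal_one, Complex.ofReal_zero]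
  refine ⟨{i // d i = 0}, inferInstance, inferInstance, V, d k, Fintype.card_subtype_lt hj, hδ,
    mul_V, ?_⟩
  rw [diagonalization]
  refine (PosSemidef.diagonal fun i => Complex.zero_le_real.2 ?_).mul_mul_conjTranspose_same U
  split_ifs with h
  · simp [h]
  · simpa using hmin i h

theorem norm_sub_compression_le {X N : Matrix n n ℂ} (hX : X.PosSemidef) (hN : N.IsHermitian)
    (hNN : N * N = N) :
    ‖X - (1 - N) * X * (1 - N)‖ ≤ 3 * √‖X‖ * √(N * X).trace.re := by
  obtain ⟨B, hB⟩ := exists_eq_conjTranspose_mul_self_of_posSemidef hX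
  have norm_B : ‖B‖ = √‖X‖ := by
    rw [hB, l2_opNorm_conjTranspose_mul_self, Real.sqrt_mul_self (norm_nonneg _)]
  have norm_N : ‖N‖ ≤ 1 := by
    have := l2_opNorm_conjTranspose_mul_self N
    rw [hN.eq, hNN] at this
    nlinarith [norm_nonneg N]
  have norm_BN : ‖B * N‖ ≤ √(N * X).trace.re := by
    refine Real.le_sqrt_of_sq_le ?_
    have NXN_eq : (B * N)ᴴ * (B * N) = N * X * N := by
      rw [conjTranspose_mul, hN.eq, hB]
      simp only [Matrix.mul_assoc]
    calc ‖B * N‖ ^ 2 = ‖N * X * N‖ := by rw [sq, ← l2_opNorm_conjTranspose_mul_self, NXN_eq]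
      _ ≤ (N * X * N).trace.re :=
        norm_le_re_trace_of_posSemidef (NXN_eq ▸ posSemidef_conjTranspose_mul_self _)
      _ = (N * X).trace.re := by rw [trace_mul_comm, ← Matrix.mul_assoc, hNN]
  have norm_XN : ‖X * N‖ ≤ √‖X‖ * √(N * X).trace.re := by
    calc ‖X * N‖ = ‖Bᴴ * (B * N)‖ := by rw [← Matrix.mul_assoc Bᴴ B N, ← hB]
      _ ≤ ‖Bᴴ‖ * ‖B * N‖ := norm_mul_le _ _
      _ ≤ √‖X‖ * √(N * X).trace.re := by rw [l2_opNorm_conjTranspose, norm_B]; gcongr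
  have norm_NX : ‖N * X‖ = ‖X * N‖ := by
    rw [← l2_opNorm_conjTranspose, conjTranspose_mul, hN.eq, hX.1.eq]
  calc ‖X - (1 - N) * X * (1 - N)‖ = ‖N * X + X * N - N * (X * N)‖ := by congr 1; noncomm_ring
    _ ≤ ‖N * X‖ + ‖X * N‖ + ‖N‖ * ‖X * N‖ :=
      (norm_sub_le _ _).trans (add_le_add (norm_add_le _ _) (norm_mul_le _ _))
    _ ≤ ‖X * N‖ + ‖X * N‖ + 1 * ‖X * N‖ := by rw [norm_NX]; gcongr
    _ ≤ 3 * √‖X‖ * √(N * X).trace.re := by linarith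

theorem exists_face_norm_sub_le (L : Matrix n n ℂ →L[ℝ] F) {A₀ : Matrix n n ℂ}
    (hA₀ : A₀.PosSemidef) (h : ∀ A : Matrix n n ℂ, A.PosDef → L A ≠ L A₀) :
    ∃ (ι : Type u) (_ : Fintype ι) (_ : DecidableEq ι) (V : Matrix n ι ℂ) (C : ℝ),
      Fintype.card ι < Fintype.card n ∧ ∀ X : Matrix n n ℂ, X.PosSemidef →
        ‖X - congruence V (congruence Vᴴ X)‖ ≤ 3 * √‖X‖ * √(C * ‖L X - L A₀‖) := by
  obtain ⟨f, G, hG, hG0, hfA₀, trace_eq⟩ := exists_posSemidef_annihilator L hA₀ h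
  obtain ⟨ι, _, _, V, δ, hcard, hδ, hVV, hGV⟩ := exists_isometry_posSemidef_sub_smul hG hG0
  refine ⟨ι, inferInstance, inferInstance, V, ‖f‖ / δ, hcard, fun X hX => ?_⟩
  have idempotent : (1 - V * Vᴴ) * (1 - V * Vᴴ) = 1 - V * Vᴴ := by
    have : V * Vᴴ * (V * Vᴴ) = V * Vᴴ := by
      rw [Matrix.mul_assoc, ← Matrix.mul_assoc Vᴴ, hVV, Matrix.one_mul]
    rw [Matrix.mul_sub, Matrix.mul_one, Matrix.sub_mul, Matrix.one_mul, this, sub_self, sub_zero]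
  have trace_le : ((1 - V * Vᴴ) * X).trace.re ≤ ‖f‖ / δ * ‖L X - L A₀‖ := by
    rw [div_mul_eq_mul_div, le_div_iff₀ hδ]
    have trace_diff := re_trace_mul_nonneg_of_posSemidef hGV hX
    rw [Matrix.sub_mul, trace_sub, Matrix.smul_mul, trace_smul, Complex.sub_re, Complex.smul_re,
      smul_eq_mul, sub_nonneg, trace_eq X hX.1, ← sub_zero (f (L X)), ← hfA₀,
      ← map_sub] at trace_diff
    rw [mul_comm]
    exact trace_diff.trans ((le_abs_self _).trans (f.le_opNorm _))
  have := norm_sub_compression_le hX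
    (isHermitian_one.sub (isHermitian_mul_conjTranspose_self V)) idempotent
  rw [sub_sub_cancel] at this
  have compression_eq : congruence V (congruence Vᴴ X) = V * Vᴴ * X * (V * Vᴴ) := by
    simp only [congruence_apply, conjTranspose_conjTranspose, Matrix.mul_assoc]
  rw [compression_eq]
  exact this.trans (by gcongr)

/- Facial reduction: without a positive definite solution all solutions lie in a proper face of the
cone, which is again a positive semidefinite cone, of smaller matrices. -/
theorem holderErrorBound_posSemidef {n : Type u} [Fintype n] [DecidableEq n]
    (L : Matrix n n ℂ →L[ℝ] F) {A₀ : Matrix n n ℂ} (hA₀ : A₀.PosSemidef) :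
    HolderErrorBound {A : Matrix n n ℂ | A.PosSemidef} L (L A₀) := by
  by_cases hsol : ∃ A : Matrix n n ℂ, A.PosDef ∧ L A = L A₀
  · obtain ⟨A, hA, hLA⟩ := hsol
    let V := selfAdjoint.submodule ℝ (Matrix n n ℂ)
    refine .of_submodule V (fun X hX => hX.1) (hLA ▸ ?_)
    exact holderErrorBound_of_mem_interior (convex_setOf_posSemidef.linear_preimage V.subtype)
      (L.comp V.subtypeL) ((mem_interior_posSemidef_iff_posDef ⟨A, hA.1⟩).2 hA)
  · push Not at hsol
    obtain ⟨ι, _, _, V, C, hcard, hface⟩ := exists_face_norm_sub_le L hA₀ hsol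
    have A₀_mem_face : congruence V (congruence Vᴴ A₀) = A₀ := by
      have := hface A₀ hA₀
      rw [sub_self, norm_zero, mul_zero, Real.sqrt_zero, mul_zero] at this
      exact (sub_eq_zero.1 (norm_le_zero_iff.1 this)).symm
    refine .of_approx_retract (congruence V) (congruence Vᴴ)
      (fun _ hX => posSemidef_congruence V hX) (fun _ hX => posSemidef_congruence Vᴴ hX)
      (fun R => ⟨3 * √R * √C, fun X hX hXR => ?_⟩) ?_
    · calc _ ≤ 3 * √‖X‖ * √(C * ‖L X - L A₀‖) := hface X hX
        _ = 3 * √‖X‖ * √C * √‖L X - L A₀‖ := by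
          rw [Real.sqrt_mul' _ (norm_nonneg _), mul_assoc (3 * √‖X‖)]
        _ ≤ 3 * √R * √C * √‖L X - L A₀‖ := by gcongr
    · have := holderErrorBound_posSemidef (L.comp (congruence V)) (posSemidef_congruence Vᴴ hA₀)
      rwa [ContinuousLinearMap.comp_apply, A₀_mem_face] at this
termination_by Fintype.card n

end FacialReduction

/-! ### The energy efficiency and its tangent inequality -/

section FeasibleCov

open Matrix
open scoped Matrix.Norms.L2Operator

/-- The real part of the trace, as a continuous real linear functional. -/
noncomputable def reTrace (n : Type*) [Fintype n] : Matrix n n ℂ →L[ℝ] ℝ :=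
  Complex.reCLM.comp (LinearMap.toContinuousLinearMap (traceLinearMap n ℝ ℂ))

theorem reTrace_apply {n : Type*} [Fintype n] (X : Matrix n n ℂ) : reTrace n X = X.trace.re :=
  rfl

variable {K N : ℕ}

theorem isClosed_feasibleCov : IsClosed (feasibleCov K N) := by
  rw [feasibleCov, Set.ofPred_forall]
  exact isClosed_iInter fun i => (isClosed_setOf_posSemidef (n := Fin N)).preimage
    (f := fun Q : CovTuple K N => Q i) (continuous_apply i)

theorem convex_feasibleCov : Convex ℝ (feasibleCov K N) :=
  fun _ hX _ hY _ _ ha hb hab i => convex_setOf_posSemidef (hX i) (hY i) ha hb hab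

theorem zero_mem_feasibleCov : (0 : CovTuple K N) ∈ feasibleCov K N :=
  fun _ => PosSemidef.zero

theorem update_mem_feasibleCov {Q : CovTuple K N} (hQ : Q ∈ feasibleCov K N) (i : Fin K)
    {A : Matrix (Fin N) (Fin N) ℂ} (hA : A.PosSemidef) :
    Function.update Q i A ∈ feasibleCov K N := by
  intro j
  obtain rfl | hj := eq_or_ne j i
  · rwa [Function.update_self]
  · rw [Function.update_of_ne hj]
    exact hQ j

/-- The sum of the traces of the covariance matrices. -/
noncomputable def traceSum (K N : ℕ) : CovTuple K N →L[ℝ] ℝ :=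
  ∑ i, (reTrace (Fin N)).comp (ContinuousLinearMap.proj i)

theorem traceSum_apply (X : CovTuple K N) : traceSum K N X = ∑ i, (X i).trace.re := by
  rw [traceSum, _root_.sum_apply]
  rfl

theorem norm_le_traceSum {Q : CovTuple K N} (hQ : Q ∈ feasibleCov K N) :
    ‖Q‖ ≤ traceSum K N Q := by
  have trace_nonneg (i : Fin K) : 0 ≤ (Q i).trace.re := re_trace_nonneg_of_posSemidef (hQ i)
  rw [traceSum_apply]
  refine (pi_norm_le_iff_of_nonneg (Finset.sum_nonneg fun i _ => trace_nonneg i)).2 fun i => ?_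
  exact (norm_le_re_trace_of_posSemidef (hQ i)).trans
    (Finset.single_le_sum (f := fun i => (Q i).trace.re) (fun j _ => trace_nonneg j)
      (Finset.mem_univ i))

theorem traceSum_nonneg {Q : CovTuple K N} (hQ : Q ∈ feasibleCov K N) : 0 ≤ traceSum K N Q :=
  (norm_nonneg Q).trans (norm_le_traceSum hQ)

end FeasibleCov

namespace MIMOBC

open Matrix
open scoped Matrix.Norms.L2Operator

variable {K N M : ℕ} {S : MIMOBC K N M} {T : Finset (Fin M)} {P Q : CovTuple K N}

section EnergyEfficiency

/-- The linear part `X ↦ σ⁻² ∑ᵢ Hᵢᴴ Xᵢ Hᵢ` of the affine map `macMatrix`. -/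
noncomputable def linPart (S : MIMOBC K N M) (T : Finset (Fin M)) :
    CovTuple K N →L[ℝ] Matrix T T ℂ :=
  (1 / S.σ ^ 2) • ∑ i, (congruence (S.activeH T i)ᴴ).comp (ContinuousLinearMap.proj i)

theorem linPart_apply (X : CovTuple K N) :
    S.linPart T X = (1 / S.σ ^ 2) • ∑ i, congruence (S.activeH T i)ᴴ (X i) := by
  rw [linPart, _root_.smul_apply, _root_.sum_apply]
  rfl

theorem macMatrix_eq_one_add_linPart (Q : CovTuple K N) :
    S.macMatrix T Q = 1 + S.linPart T Q := by
  simp only [macMatrix, linPart_apply, congruence_apply, conjTranspose_conjTranspose,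
    Complex.coe_smul]

theorem macMatrix_sub (P Q : CovTuple K N) :
    S.macMatrix T P - S.macMatrix T Q = S.linPart T (P - Q) := by
  rw [macMatrix_eq_one_add_linPart, macMatrix_eq_one_add_linPart, add_sub_add_left_eq_sub, map_sub]

theorem posSemidef_linPart (hQ : Q ∈ feasibleCov K N) : (S.linPart T Q).PosSemidef := by
  rw [linPart_apply]
  exact (posSemidef_sum _ fun i _ => posSemidef_congruence _ (hQ i)).smul
    (show 0 ≤ 1 / S.σ ^ 2 by positivity)

theorem posSemidef_macMatrix_sub_one (hQ : Q ∈ feasibleCov K N) :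
    (S.macMatrix T Q - 1).PosSemidef := by
  rw [macMatrix_eq_one_add_linPart, add_sub_cancel_left]
  exact posSemidef_linPart hQ

theorem posDef_macMatrix (hQ : Q ∈ feasibleCov K N) : (S.macMatrix T Q).PosDef :=
  posDef_of_posSemidef_sub_one (posSemidef_macMatrix_sub_one hQ)

theorem totalPower_eq (Q : CovTuple K N) :
    S.totalPower T Q = traceSum K N Q / S.η + S.fixedPower T := by
  rw [totalPower, traceSum_apply]

theorem fixedPower_le_totalPower (hη : 0 < S.η) (hQ : Q ∈ feasibleCov K N) :
    S.fixedPower T ≤ S.totalPower T Q := by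
  rw [totalPower_eq]
  exact le_add_of_nonneg_left (div_nonneg (traceSum_nonneg hQ) hη.le)

theorem totalPower_pos (hη : 0 < S.η) (hp : 0 < S.fixedPower T) (hQ : Q ∈ feasibleCov K N) :
    0 < S.totalPower T Q :=
  hp.trans_le (fixedPower_le_totalPower hη hQ)

/-- The rate per unit of bandwidth, in nats. -/
noncomputable def logDet (S : MIMOBC K N M) (T : Finset (Fin M)) (Q : CovTuple K N) : ℝ :=
  Real.log (S.macMatrix T Q).det.re

/-- The factor `W / log 2` that turns `logDet` into the sum rate in bits. -/
noncomputable def natBandwidth (S : MIMOBC K N M) : ℝ :=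
  S.W / Real.log 2

theorem natBandwidth_pos (hW : 0 < S.W) : 0 < S.natBandwidth :=
  div_pos hW (Real.log_pos one_lt_two)

theorem ee_eq (Q : CovTuple K N) :
    S.ee T Q = S.natBandwidth * S.logDet T Q / S.totalPower T Q := by
  rw [ee, sumRate, natBandwidth, logDet, Real.logb, div_mul_eq_mul_div, ← mul_div_assoc]

theorem totalPower_mul_ee (hη : 0 < S.η) (hp : 0 < S.fixedPower T) (hQ : Q ∈ feasibleCov K N) :
    S.totalPower T Q * S.ee T Q = S.natBandwidth * S.logDet T Q := by
  rw [ee_eq, mul_div_cancel₀ _ (totalPower_pos hη hp hQ).ne']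

/-- The derivative at `P` of Dinkelbach's parametrized objective
`Q ↦ sumRate Q - ee P * totalPower Q`. Up to the positive factor `totalPower P`, it is the
derivative of `ee` at `P`. -/
noncomputable def dinkelbachDeriv (S : MIMOBC K N M) (T : Finset (Fin M)) (P : CovTuple K N) :
    CovTuple K N →L[ℝ] ℝ :=
  S.natBandwidth • (reTrace T).comp
    ((ContinuousLinearMap.mul ℝ (Matrix T T ℂ) (S.macMatrix T P)⁻¹).comp (S.linPart T)) -
  (S.ee T P / S.η) • traceSum K N

theorem dinkelbachDeriv_apply (P X : CovTuple K N) : S.dinkelbachDeriv T P X =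
    S.natBandwidth * reTrace T ((S.macMatrix T P)⁻¹ * S.linPart T X) -
      S.ee T P / S.η * traceSum K N X :=
  rfl

theorem totalPower_mul_ee_sub_add_logDetDivergence (hη : 0 < S.η) (hp : 0 < S.fixedPower T)
    (hP : P ∈ feasibleCov K N) (hQ : Q ∈ feasibleCov K N) :
    S.totalPower T Q * (S.ee T Q - S.ee T P) +
        S.natBandwidth * logDetDivergence (S.macMatrix T P) (S.macMatrix T Q) =
      S.dinkelbachDeriv T P (Q - P) := by
  have power_P : S.ee T P * S.totalPower T P = S.natBandwidth * S.logDet T P := by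
    rw [mul_comm, totalPower_mul_ee hη hp hP]
  have power_Q := totalPower_mul_ee hη hp hQ
  have power_sub : S.totalPower T Q = S.totalPower T P + traceSum K N (Q - P) / S.η := by
    rw [totalPower_eq, totalPower_eq, map_sub]
    ring
  rw [mul_sub, power_Q, power_sub, dinkelbachDeriv_apply, logDetDivergence, macMatrix_sub,
    ← reTrace_apply, ← logDet, ← logDet]
  linear_combination -power_P

theorem totalPower_mul_ee_sub_le (hW : 0 < S.W) (hη : 0 < S.η) (hp : 0 < S.fixedPower T)
    (hP : P ∈ feasibleCov K N) (hQ : Q ∈ feasibleCov K N) :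
    S.totalPower T Q * (S.ee T Q - S.ee T P) ≤ S.dinkelbachDeriv T P (Q - P) := by
  rw [← totalPower_mul_ee_sub_add_logDetDivergence hη hp hP hQ]
  exact le_add_of_nonneg_right (mul_nonneg (natBandwidth_pos hW).le
    (logDetDivergence_nonneg (posDef_macMatrix hP) (posDef_macMatrix hQ)))

theorem logDetDivergence_macMatrix_one_le_logDet (hQ : Q ∈ feasibleCov K N) :
    logDetDivergence (S.macMatrix T Q) 1 ≤ S.logDet T Q := by
  have trace_nonneg := re_trace_mul_nonneg_of_posSemidef
    (posDef_macMatrix (S := S) (T := T) hQ).inv.posSemidef (posSemidef_linPart (S := S) hQ)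
  have sub_eq : 1 - S.macMatrix T Q = -S.linPart T Q := by
    rw [macMatrix_eq_one_add_linPart, sub_add_cancel_left]
  rw [logDetDivergence, sub_eq, Matrix.mul_neg, trace_neg, Complex.neg_re, det_one, Complex.one_re,
    Real.log_one, sub_zero, ← logDet]
  linarith

theorem ee_nonneg (hW : 0 < S.W) (hη : 0 < S.η) (hp : 0 < S.fixedPower T)
    (hQ : Q ∈ feasibleCov K N) : 0 ≤ S.ee T Q := by
  rw [ee_eq]
  refine div_nonneg (mul_nonneg (natBandwidth_pos hW).le ?_) (totalPower_pos hη hp hQ).le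
  exact (logDetDivergence_nonneg (posDef_macMatrix hQ) PosDef.one).trans
    (logDetDivergence_macMatrix_one_le_logDet hQ)

theorem ee_pos (hW : 0 < S.W) (hη : 0 < S.η) (hp : 0 < S.fixedPower T)
    (hQ : Q ∈ feasibleCov K N) (h : S.linPart T Q ≠ 0) : 0 < S.ee T Q := by
  have macMatrix_ne_one : S.macMatrix T Q ≠ 1 := by
    rwa [macMatrix_eq_one_add_linPart, Ne, add_eq_left]
  rw [ee_eq]
  refine div_pos (mul_pos (natBandwidth_pos hW) ?_) (totalPower_pos hη hp hQ)
  exact (logDetDivergence_pos (posDef_macMatrix hQ) PosDef.one macMatrix_ne_one).trans_le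
    (logDetDivergence_macMatrix_one_le_logDet hQ)

theorem logDet_le {δ : ℝ} (hδ : 0 < δ) (hQ : Q ∈ feasibleCov K N) : S.logDet T Q ≤
    δ * reTrace T (S.linPart T Q) + Fintype.card T * (δ - 1 - Real.log δ) := by
  have mac_posDef := posDef_macMatrix (S := S) (T := T) hQ
  have divergence_nonneg := logDetDivergence_nonneg PosDef.one (mac_posDef.smul hδ)
  rw [logDetDivergence, log_re_det_smul mac_posDef hδ, ← logDet, inv_one, Matrix.one_mul, det_one,
    Complex.one_re, Real.log_one, zero_add, ← reTrace_apply, map_sub, map_smul,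
    macMatrix_eq_one_add_linPart, map_add, smul_eq_mul, reTrace_apply 1, trace_one,
    Complex.natCast_re] at divergence_nonneg
  linarith

theorem exists_forall_ee_le (hW : 0 < S.W) (hη : 0 < S.η) (hp : 0 < S.fixedPower T) :
    ∃ C, 0 ≤ C ∧ ∀ Q ∈ feasibleCov K N, S.ee T Q ≤ C := by
  have := natBandwidth_pos hW
  set L := (reTrace T).comp (S.linPart T)
  refine ⟨S.natBandwidth * ‖L‖ * S.η, by positivity, fun Q hQ => ?_⟩
  rw [ee_eq, div_le_iff₀ (totalPower_pos hη hp hQ), mul_assoc, mul_assoc]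
  gcongr
  have traceSum_le : traceSum K N Q ≤ S.η * S.totalPower T Q := by
    rw [totalPower_eq, mul_add, mul_div_cancel₀ _ hη.ne']
    exact le_add_of_nonneg_right (by positivity)
  calc S.logDet T Q ≤ L Q := by simpa [L] using logDet_le (S := S) (T := T) one_pos hQ
    _ ≤ ‖L‖ * ‖Q‖ := (le_abs_self _).trans (L.le_opNorm Q)
    _ ≤ ‖L‖ * (S.η * S.totalPower T Q) := by
      gcongr
      exact (norm_le_traceSum hQ).trans traceSum_le

theorem exists_norm_dinkelbachDeriv_le (hW : 0 < S.W) (hη : 0 < S.η) (hp : 0 < S.fixedPower T) :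
    ∃ C, 0 ≤ C ∧ ∀ P ∈ feasibleCov K N, ‖S.dinkelbachDeriv T P‖ ≤ C := by
  obtain ⟨l, hl, ee_le⟩ := exists_forall_ee_le hW hη hp
  have := natBandwidth_pos hW
  set C := S.natBandwidth * (‖reTrace T‖ * ‖S.linPart T‖) + l / S.η * ‖traceSum K N‖
  refine ⟨C, by positivity, fun P hP => ?_⟩
  refine ContinuousLinearMap.opNorm_le_bound _ (by positivity) fun X => ?_
  have inv_mul_le : ‖(S.macMatrix T P)⁻¹ * S.linPart T X‖ ≤ ‖S.linPart T‖ * ‖X‖ := by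
    refine (norm_mul_le _ _).trans ?_
    refine (mul_le_of_le_one_left (norm_nonneg _) ?_).trans ((S.linPart T).le_opNorm X)
    exact norm_inv_le_one_of_posSemidef_sub_one (posSemidef_macMatrix_sub_one hP)
  rw [dinkelbachDeriv_apply]
  refine (norm_sub_le _ _).trans ?_
  rw [norm_mul, norm_mul, Real.norm_of_nonneg this.le,
    Real.norm_of_nonneg (div_nonneg (ee_nonneg hW hη hp hP) hη.le)]
  calc _ ≤ S.natBandwidth * (‖reTrace T‖ * (‖S.linPart T‖ * ‖X‖)) +
        l / S.η * (‖traceSum K N‖ * ‖X‖) := by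
        gcongr
        · exact ((reTrace T).le_opNorm _).trans (by gcongr)
        · exact ee_le P hP
        · exact (traceSum K N).le_opNorm X
    _ = C * ‖X‖ := by ring

theorem exists_abs_ee_sub_le (hW : 0 < S.W) (hη : 0 < S.η) (hp : 0 < S.fixedPower T) :
    ∃ C, 0 ≤ C ∧ ∀ P ∈ feasibleCov K N, ∀ Q ∈ feasibleCov K N,
      |S.ee T P - S.ee T Q| ≤ C * ‖P - Q‖ := by
  obtain ⟨C, hC, deriv_le⟩ := exists_norm_dinkelbachDeriv_le hW hη hp
  have ee_sub_le {P Q : CovTuple K N} (hP : P ∈ feasibleCov K N) (hQ : Q ∈ feasibleCov K N) :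
      S.ee T Q - S.ee T P ≤ C / S.fixedPower T * ‖Q - P‖ := by
    rcases le_total (S.ee T Q) (S.ee T P) with h | h
    · exact (sub_nonpos.2 h).trans (by positivity)
    rw [div_mul_eq_mul_div, le_div_iff₀' hp]
    calc S.fixedPower T * (S.ee T Q - S.ee T P) ≤ S.totalPower T Q * (S.ee T Q - S.ee T P) :=
          mul_le_mul_of_nonneg_right (fixedPower_le_totalPower hη hQ) (sub_nonneg.2 h)
      _ ≤ S.dinkelbachDeriv T P (Q - P) := totalPower_mul_ee_sub_le hW hη hp hP hQ
      _ ≤ C * ‖Q - P‖ :=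
        (le_abs_self _).trans ((S.dinkelbachDeriv T P).le_of_opNorm_le (deriv_le P hP) _)
  refine ⟨C / S.fixedPower T, by positivity, fun P hP Q hQ => abs_sub_le_iff.2 ⟨?_, ?_⟩⟩
  · exact ee_sub_le hQ hP
  · exact norm_sub_rev P Q ▸ ee_sub_le hP hQ

theorem continuousOn_ee (hW : 0 < S.W) (hη : 0 < S.η) (hp : 0 < S.fixedPower T) :
    ContinuousOn (S.ee T) (feasibleCov K N) := by
  obtain ⟨C, hC, ee_sub_le⟩ := exists_abs_ee_sub_le hW hη hp
  refine LipschitzOnWith.continuousOn (K := ⟨C, hC⟩) (.of_dist_le_mul fun P hP Q hQ => ?_)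
  rw [dist_eq_norm P Q]
  exact ee_sub_le P hP Q hQ

theorem exists_norm_dinkelbachDeriv_sub_le (hW : 0 < S.W) (hη : 0 < S.η)
    (hp : 0 < S.fixedPower T) :
    ∃ C, 0 ≤ C ∧ ∀ P ∈ feasibleCov K N, ∀ Q ∈ feasibleCov K N,
      ‖S.dinkelbachDeriv T P - S.dinkelbachDeriv T Q‖ ≤ C * ‖P - Q‖ := by
  obtain ⟨l, hl, ee_sub_le⟩ := exists_abs_ee_sub_le hW hη hp
  have := natBandwidth_pos hW
  set C := S.natBandwidth * (‖reTrace T‖ * (‖S.linPart T‖ * ‖S.linPart T‖)) +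
    l / S.η * ‖traceSum K N‖
  refine ⟨C, by positivity, fun P hP Q hQ => ?_⟩
  refine ContinuousLinearMap.opNorm_le_bound _ (by positivity) fun X => ?_
  have inv_sub_inv_le : ‖(S.macMatrix T P)⁻¹ - (S.macMatrix T Q)⁻¹‖ ≤ ‖S.linPart T‖ * ‖P - Q‖ := by
    refine (norm_inv_sub_inv_le_of_posSemidef_sub_one (posSemidef_macMatrix_sub_one hP)
      (posSemidef_macMatrix_sub_one hQ)).trans ?_
    rw [macMatrix_sub]
    exact (S.linPart T).le_opNorm _
  have deriv_sub_eq : (S.dinkelbachDeriv T P - S.dinkelbachDeriv T Q) X = S.natBandwidth *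
        reTrace T (((S.macMatrix T P)⁻¹ - (S.macMatrix T Q)⁻¹) * S.linPart T X) -
      (S.ee T P - S.ee T Q) / S.η * traceSum K N X := by
    rw [_root_.sub_apply, dinkelbachDeriv_apply, dinkelbachDeriv_apply, Matrix.sub_mul,
      map_sub]
    ring
  rw [deriv_sub_eq]
  refine (norm_sub_le _ _).trans ?_
  rw [norm_mul, norm_mul, norm_div, Real.norm_of_nonneg this.le, Real.norm_of_nonneg hη.le]
  calc _ ≤ S.natBandwidth * (‖reTrace T‖ * ((‖S.linPart T‖ * ‖P - Q‖) * (‖S.linPart T‖ * ‖X‖))) +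
        l * ‖P - Q‖ / S.η * (‖traceSum K N‖ * ‖X‖) := by
        gcongr
        · refine ((reTrace T).le_opNorm _).trans ?_
          gcongr
          exact (norm_mul_le _ _).trans (by gcongr; exact (S.linPart T).le_opNorm X)
        · exact ee_sub_le P hP Q hQ
        · exact (traceSum K N).le_opNorm X
    _ = C * ‖P - Q‖ * ‖X‖ := by ring

theorem dinkelbachDeriv_sub_nonpos_of_forall_ee_le (hW : 0 < S.W) (hη : 0 < S.η)
    (hp : 0 < S.fixedPower T) (hP : P ∈ feasibleCov K N) (hQ : Q ∈ feasibleCov K N)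
    (h : ∀ t : ℝ, 0 < t → t ≤ 1 → S.ee T (P + t • (Q - P)) ≤ S.ee T P) :
    S.dinkelbachDeriv T P (Q - P) ≤ 0 := by
  obtain ⟨C, hC, deriv_sub_le⟩ := exists_norm_dinkelbachDeriv_sub_le hW hη hp
  have deriv_le (t : ℝ) (ht : 0 < t) (ht1 : t ≤ 1) :
      S.dinkelbachDeriv T P (Q - P) ≤ C * ‖Q - P‖ ^ 2 * t := by
    set R := P + t • (Q - P) with hR
    have hRmem : R ∈ feasibleCov K N := convex_feasibleCov.add_smul_sub_mem hP hQ ⟨ht.le, ht1⟩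
    have sub_R : P - R = (-t) • (Q - P) := by rw [hR, neg_smul, sub_add_cancel_left]
    have deriv_R_nonpos : S.dinkelbachDeriv T R (Q - P) ≤ 0 := by
      have tangent := totalPower_mul_ee_sub_le hW hη hp hRmem hP
      rw [sub_R, map_smul, smul_eq_mul] at tangent
      have := (mul_nonneg (totalPower_pos hη hp hP).le (sub_nonneg.2 (h t ht ht1))).trans tangent
      exact nonpos_of_mul_nonneg_right this (neg_neg_of_pos ht)
    calc S.dinkelbachDeriv T P (Q - P)
        ≤ (S.dinkelbachDeriv T P - S.dinkelbachDeriv T R) (Q - P) :=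
          le_sub_self_iff _ |>.2 deriv_R_nonpos
      _ ≤ C * ‖P - R‖ * ‖Q - P‖ := (le_abs_self _).trans
          (ContinuousLinearMap.le_of_opNorm_le _ (deriv_sub_le P hP R hRmem) _)
      _ = C * ‖Q - P‖ ^ 2 * t := by
          rw [sub_R, norm_smul, norm_neg, Real.norm_of_nonneg ht.le]
          ring
  have bound_tendsto : Tendsto (fun t : ℝ => C * ‖Q - P‖ ^ 2 * t) (𝓝[>] 0) (𝓝 0) :=
    tendsto_nhdsWithin_of_tendsto_nhds (Continuous.tendsto' (by fun_prop) _ _ (mul_zero _))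
  refine ge_of_tendsto bound_tendsto ?_
  filter_upwards [self_mem_nhdsWithin, mem_nhdsWithin_of_mem_nhds (Iic_mem_nhds one_pos)]
    with t ht ht1 using deriv_le t ht ht1

theorem exists_traceSum_le_of_le_ee (hW : 0 < S.W) (hη : 0 < S.η) (hp : 0 < S.fixedPower T)
    {α : ℝ} (hα : 0 < α) :
    ∃ R, ∀ Q ∈ feasibleCov K N, α ≤ S.ee T Q → traceSum K N Q ≤ R := by
  have := natBandwidth_pos hW
  set L := (reTrace T).comp (S.linPart T)
  set δ := α / (2 * S.η * S.natBandwidth * (‖L‖ + 1)) with hδ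
  set D := Fintype.card T * (δ - 1 - Real.log δ)
  refine ⟨2 * S.η / α * (S.natBandwidth * D), fun Q hQ hαQ => ?_⟩
  have slope_le : S.natBandwidth * (δ * ‖L‖) ≤ α / (2 * S.η) := by
    calc S.natBandwidth * (δ * ‖L‖) ≤ S.natBandwidth * (δ * (‖L‖ + 1)) := by gcongr; simp
      _ = α / (2 * S.η) := by rw [hδ]; field_simp
  have L_le : L Q ≤ ‖L‖ * traceSum K N Q := by
    refine (le_abs_self _).trans ((L.le_opNorm Q).trans ?_)
    gcongr
    exact norm_le_traceSum hQ
  have power_le : α * (traceSum K N Q / S.η) ≤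
      α / (2 * S.η) * traceSum K N Q + S.natBandwidth * D := by
    calc α * (traceSum K N Q / S.η) ≤ S.ee T Q * S.totalPower T Q := by
          rw [totalPower_eq]
          have := div_nonneg (traceSum_nonneg hQ) hη.le
          exact mul_le_mul hαQ (le_add_of_nonneg_right hp.le) this (hα.le.trans hαQ)
      _ = S.natBandwidth * S.logDet T Q := by rw [mul_comm, totalPower_mul_ee hη hp hQ]
      _ ≤ S.natBandwidth * (δ * (‖L‖ * traceSum K N Q) + D) := by
          gcongr
          refine (logDet_le (by positivity) hQ).trans (add_le_add_left ?_ D)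
          exact mul_le_mul_of_nonneg_left L_le (by positivity)
      _ = S.natBandwidth * (δ * ‖L‖) * traceSum K N Q + S.natBandwidth * D := by ring
      _ ≤ _ := by
          have := mul_le_mul_of_nonneg_right slope_le (traceSum_nonneg hQ)
          gcongr
  have half_le : α / (2 * S.η) * traceSum K N Q ≤ S.natBandwidth * D := by
    have : α * (traceSum K N Q / S.η) = 2 * (α / (2 * S.η) * traceSum K N Q) := by field_simp
    linarith
  rw [div_mul_eq_mul_div, le_div_iff₀ hα]
  rw [div_mul_eq_mul_div, div_le_iff₀ (by positivity)] at half_le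
  linarith

theorem exists_isMaxOn_ee_of_isClosed (hW : 0 < S.W) (hη : 0 < S.η) (hp : 0 < S.fixedPower T)
    {C : Set (CovTuple K N)} (hC : IsClosed C) (hCf : C ⊆ feasibleCov K N)
    (hpos : ∃ Q ∈ C, 0 < S.ee T Q) : ∃ Q ∈ C, IsMaxOn (S.ee T) C Q := by
  obtain ⟨Q₀, hQ₀, hα⟩ := hpos
  obtain ⟨R, traceSum_le⟩ := exists_traceSum_le_of_le_ee (K := K) (N := N) hW hη hp hα
  have : ProperSpace (CovTuple K N) := FiniteDimensional.proper ℝ _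
  refine ((continuousOn_ee hW hη hp).mono hCf).exists_isMaxOn' hC hQ₀ ?_
  refine eventually_inf_principal.2 (mem_of_superset
    (isCompact_closedBall (0 : CovTuple K N) R).compl_mem_cocompact fun Q hQR hQ => ?_)
  by_contra! ee_lt
  refine hQR (mem_closedBall_zero_iff.2 ?_)
  exact (norm_le_traceSum (hCf hQ)).trans (traceSum_le Q (hCf hQ) ee_lt.le)

end EnergyEfficiency

end MIMOBC

/-! ### Block updates and sweeps -/

section SufficientDecrease

theorem mul_rpow_mul_sub_le {a b γ : ℝ} (ha : 0 ≤ a) (hb : 0 ≤ b) (hγ : 0 ≤ γ) (hγ1 : γ ≤ 1) :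
    γ * a ^ γ * (a - b) ≤ a * (a ^ γ - b ^ γ) := by
  obtain rfl | ha := ha.eq_or_lt
  · have : 0 ≤ γ * 0 ^ γ * b := mul_nonneg (mul_nonneg hγ (Real.rpow_nonneg le_rfl γ)) hb
    linarith
  have bernoulli : (b / a) ^ γ ≤ 1 + γ * (b / a - 1) := by
    have := rpow_one_add_le_one_add_mul_self (s := b / a - 1)
      (by linarith [div_nonneg hb ha.le]) hγ hγ1
    rwa [add_sub_cancel] at this
  rw [Real.div_rpow hb ha.le, div_le_iff₀ (Real.rpow_pos_of_pos ha γ)] at bernoulli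
  calc γ * a ^ γ * (a - b) = a * (a ^ γ - (1 + γ * (b / a - 1)) * a ^ γ) := by field_simp; ring
    _ ≤ a * (a ^ γ - b ^ γ) := by gcongr

theorem le_half_add_mul_rpow_sub_rpow {a b d d' B C γ : ℝ} (hb : 0 ≤ b) (hba : b ≤ a) (hd : 0 ≤ d)
    (hB : 0 ≤ B) (hC : 0 ≤ C) (hγ : 0 < γ) (hγ1 : γ ≤ 1) (hd' : d' ^ 2 ≤ B * (a - b))
    (ha : a ≤ C * d * a ^ γ) : d' ≤ d / 2 + B * C / γ * (a ^ γ - b ^ γ) := by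
  have rpow_sub_nonneg : 0 ≤ a ^ γ - b ^ γ := sub_nonneg.2 (Real.rpow_le_rpow hb hba hγ.le)
  set u := B * C / γ * (a ^ γ - b ^ γ) with hu
  have hu0 : 0 ≤ u := by positivity
  have sub_le : γ * (a - b) ≤ C * d * (a ^ γ - b ^ γ) := by
    obtain rfl | ha0 := (hb.trans hba).eq_or_lt
    · rw [le_antisymm hba hb, sub_self, sub_self, mul_zero, mul_zero]
    · refine le_of_mul_le_mul_left ?_ (Real.rpow_pos_of_pos ha0 γ)
      calc a ^ γ * (γ * (a - b)) = γ * a ^ γ * (a - b) := by ring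
        _ ≤ a * (a ^ γ - b ^ γ) := mul_rpow_mul_sub_le ha0.le hb hγ.le hγ1
        _ ≤ C * d * a ^ γ * (a ^ γ - b ^ γ) := by gcongr
        _ = a ^ γ * (C * d * (a ^ γ - b ^ γ)) := by ring
  have sq_le : d' ^ 2 ≤ d * u := by
    calc d' ^ 2 ≤ B / γ * (γ * (a - b)) := hd'.trans_eq (by field_simp)
      _ ≤ B / γ * (C * d * (a ^ γ - b ^ γ)) := by gcongr
      _ = d * u := by rw [hu]; ring
  refine (le_abs_self d').trans (abs_le_of_sq_le_sq ?_ (by positivity))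
  linarith [sq_nonneg (d / 2), sq_nonneg u, add_sq (d / 2) u]

theorem summable_of_le_half_add_sub {d φ : ℕ → ℝ} (hd : ∀ k, 0 ≤ d k) (hφ : ∀ k, 0 ≤ φ k)
    (h : ∀ k, d (k + 1) ≤ d k / 2 + (φ k - φ (k + 1))) : Summable d := by
  have sum_le (n : ℕ) :
      ∑ k ∈ Finset.range n, d k ≤ 2 * (d 0 - d n) + 2 * (φ 0 - φ n) := by
    induction n with
    | zero => simp
    | succ n ih =>
      rw [Finset.sum_range_succ]
      linarith [h n]
  exact summable_of_sum_range_le (c := 2 * d 0 + 2 * φ 0) hd fun n => by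
    linarith [sum_le n, hd n, hφ n]

theorem summable_of_sufficient_decrease {r d : ℕ → ℝ} {B C γ : ℝ} (hB : 0 ≤ B) (hC : 0 ≤ C)
    (hγ : 0 < γ) (hγ1 : γ ≤ 1) (hr : ∀ k, 0 ≤ r k) (hr_anti : Antitone r) (hd : ∀ k, 0 ≤ d k)
    (h_decrease : ∀ k, d k ^ 2 ≤ B * (r k - r (k + 1)))
    (h_gap : ∀ k, r (k + 1) ≤ C * d k * r (k + 1) ^ γ) : Summable d := by
  refine summable_of_le_half_add_sub (φ := fun k => B * C / γ * r (k + 1) ^ γ) hd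
    (fun k => mul_nonneg (by positivity) (Real.rpow_nonneg (hr _) γ)) fun k => ?_
  rw [← mul_sub]
  exact le_half_add_mul_rpow_sub_rpow (hr _) (hr_anti (Nat.le_succ _)) (hd k) hB hC hγ hγ1
    (h_decrease (k + 1)) (h_gap k)

end SufficientDecrease

namespace MIMOBC

open Matrix
open scoped Matrix.Norms.L2Operator

variable {K N M : ℕ} {S : MIMOBC K N M} {T : Finset (Fin M)} {P Q : CovTuple K N} {i : Fin K}
  {A B : Matrix (Fin N) (Fin N) ℂ}

section BlockMaximizer

theorem linPart_single (i : Fin K) (X : Matrix (Fin N) (Fin N) ℂ) :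
    S.linPart T (Pi.single i X) = (1 / S.σ ^ 2) • congruence (S.activeH T i)ᴴ X := by
  rw [linPart_apply, Finset.sum_eq_single i]
  · rw [Pi.single_eq_same]
  · intro j _ hj
    rw [Pi.single_eq_of_ne hj, map_zero]
  · exact fun h => absurd (Finset.mem_univ i) h

theorem traceSum_single (i : Fin K) (X : Matrix (Fin N) (Fin N) ℂ) :
    traceSum K N (Pi.single i X) = X.trace.re := by
  rw [traceSum_apply, Finset.sum_eq_single i]
  · rw [Pi.single_eq_same]
  · intro j _ hj
    rw [Pi.single_eq_of_ne hj, trace_zero, Complex.zero_re]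
  · exact fun h => absurd (Finset.mem_univ i) h

/-- The gradient at `P` of the sum rate with respect to the covariance matrix of user `i`, for the
inner product `(X, Y) ↦ re tr (X Y)` on Hermitian matrices. -/
noncomputable def blockGrad (S : MIMOBC K N M) (T : Finset (Fin M)) (P : CovTuple K N)
    (i : Fin K) : Matrix (Fin N) (Fin N) ℂ :=
  (S.natBandwidth / S.σ ^ 2) • congruence (S.activeH T i) (S.macMatrix T P)⁻¹

theorem dinkelbachDeriv_single (P : CovTuple K N) (i : Fin K) (X : Matrix (Fin N) (Fin N) ℂ) :
    S.dinkelbachDeriv T P (Pi.single i X) =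
      ((S.blockGrad T P i - (S.ee T P / S.η) • 1) * X).trace.re := by
  have trace_cycle : ((S.macMatrix T P)⁻¹ * congruence (S.activeH T i)ᴴ X).trace =
      (congruence (S.activeH T i) (S.macMatrix T P)⁻¹ * X).trace := by
    rw [congruence_apply, congruence_apply, conjTranspose_conjTranspose, Matrix.mul_assoc,
      Matrix.mul_assoc (S.activeH T i * _), trace_mul_comm (S.activeH T i * _),
      ← trace_mul_comm ((S.activeH T i)ᴴ * _)]
    simp only [Matrix.mul_assoc]
  rw [dinkelbachDeriv_apply, linPart_single, traceSum_single, Matrix.mul_smul, map_smul,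
    reTrace_apply, trace_cycle, blockGrad, Matrix.sub_mul, Matrix.smul_mul, Matrix.smul_mul,
    Matrix.one_mul, trace_sub, trace_smul, trace_smul, Complex.sub_re, Complex.smul_re,
    Complex.smul_re, smul_eq_mul, smul_eq_mul, smul_eq_mul]
  ring

theorem isHermitian_blockGrad (hP : P ∈ feasibleCov K N) (i : Fin K) :
    (S.blockGrad T P i).IsHermitian :=
  (posSemidef_congruence _ (posDef_macMatrix hP).inv.posSemidef).isHermitian.smul
    (IsSelfAdjoint.all _)

theorem linPart_update_one_ne_zero (hσ : 0 < S.σ) (hH : S.activeH T i ≠ 0)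
    (hQ : Q ∈ feasibleCov K N) : S.linPart T (Function.update Q i 1) ≠ 0 := by
  intro h
  have hQ' := update_mem_feasibleCov hQ i PosSemidef.one
  rw [linPart_apply, smul_eq_zero_iff_right (by positivity)] at h
  have summand_posSemidef (j : Fin K) :=
    posSemidef_congruence (S.activeH T j)ᴴ (hQ' j)
  have trace_sum_eq_zero :
      ∑ j, (congruence (S.activeH T j)ᴴ (Function.update Q i 1 j)).trace.re = 0 := by
    rw [← Complex.re_sum, ← trace_sum, h, trace_zero, Complex.zero_re]
  have trace_eq_zero := (Finset.sum_eq_zero_iff_of_nonneg fun j _ =>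
    re_trace_nonneg_of_posSemidef (summand_posSemidef j)).1 trace_sum_eq_zero i (Finset.mem_univ i)
  rw [re_trace_eq_zero_iff_of_posSemidef (summand_posSemidef i), Function.update_self,
    congruence_apply, Matrix.mul_one, conjTranspose_conjTranspose,
    conjTranspose_mul_self_eq_zero] at trace_eq_zero
  exact hH trace_eq_zero

theorem ee_update_one_pos (hσ : 0 < S.σ) (hW : 0 < S.W) (hη : 0 < S.η) (hp : 0 < S.fixedPower T)
    (hH : S.activeH T i ≠ 0) (hQ : Q ∈ feasibleCov K N) :
    0 < S.ee T (Function.update Q i 1) :=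
  ee_pos hW hη hp (update_mem_feasibleCov hQ i PosSemidef.one) (linPart_update_one_ne_zero hσ hH hQ)

/-- The covariance matrices of user `i` that are supported on the receive space of its channel, in
which every block maximizer lies. -/
noncomputable def channelRange (S : MIMOBC K N M) (T : Finset (Fin M)) (i : Fin K) :
    Submodule ℝ (Matrix (Fin N) (Fin N) ℂ) :=
  (congruence (S.activeH T i)).range

theorem exists_norm_le_norm_linPart_single (hσ : 0 < S.σ) :
    ∃ C, 0 ≤ C ∧ ∀ i, ∀ X ∈ S.channelRange T i, ‖X‖ ≤ C * ‖S.linPart T (Pi.single i X)‖ := by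
  have exists_bound (i : Fin K) : ∃ C, 0 ≤ C ∧ ∀ X ∈ S.channelRange T i,
      ‖X‖ ≤ C * ‖S.linPart T (Pi.single i X)‖ := by
    let f := (S.linPart T).toLinearMap ∘ₗ LinearMap.single ℝ _ i ∘ₗ (S.channelRange T i).subtype
    have ker_eq_bot : LinearMap.ker f = ⊥ := by
      rw [LinearMap.ker_eq_bot']
      rintro ⟨_, Y, rfl⟩ h
      have gram_eq_zero : congruence (S.activeH T i)ᴴ (congruence (S.activeH T i) Y) = 0 := by
        have : S.linPart T (Pi.single i (congruence (S.activeH T i) Y)) = 0 := h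
        rwa [linPart_single, smul_eq_zero_iff_right (by positivity)] at this
      rw [congruence_apply, congruence_apply, conjTranspose_conjTranspose] at gram_eq_zero
      have cancel_left : S.activeH T i * (Y * (S.activeH T i)ᴴ * S.activeH T i) = 0 := by
        rw [← conjTranspose_mul_self_mul_eq_zero]
        simpa only [Matrix.mul_assoc] using gram_eq_zero
      have cancel_right : S.activeH T i * Y * (S.activeH T i)ᴴ = 0 := by
        rw [← mul_conjTranspose_mul_self_eq_zero]
        simpa only [Matrix.mul_assoc] using cancel_left
      exact Subtype.ext ((congruence_apply _ _).trans cancel_right)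
    obtain ⟨C, -, hC⟩ := f.exists_antilipschitzWith ker_eq_bot
    exact ⟨C, C.2, fun X hX => hC.le_mul_norm (map_zero f) ⟨X, hX⟩⟩
  choose C hC h using exists_bound
  refine ⟨∑ i, C i, Finset.sum_nonneg fun i _ => hC i, fun i X hX => (h i X hX).trans ?_⟩
  gcongr
  exact Finset.single_le_sum (fun j _ => hC j) (Finset.mem_univ i)

theorem update_sub_update (Q : CovTuple K N) (i : Fin K) (A B : Matrix (Fin N) (Fin N) ℂ) :
    Function.update Q i B - Function.update Q i A = Pi.single i (B - A) := by
  rw [← Function.update_sub, sub_self, Pi.single]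

namespace IsBlockMaximizer

theorem ee_pos (hσ : 0 < S.σ) (hW : 0 < S.W) (hη : 0 < S.η) (hp : 0 < S.fixedPower T)
    (hH : S.activeH T i ≠ 0) (hQ : Q ∈ feasibleCov K N) (hA : S.IsBlockMaximizer T i Q A) :
    0 < S.ee T (Function.update Q i A) :=
  (ee_update_one_pos hσ hW hη hp hH hQ).trans_le (hA.2 1 PosSemidef.one)

theorem update_mem (hQ : Q ∈ feasibleCov K N) (hA : S.IsBlockMaximizer T i Q A) :
    Function.update Q i A ∈ feasibleCov K N :=
  update_mem_feasibleCov hQ i hA.1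

theorem dinkelbachDeriv_nonpos (hW : 0 < S.W) (hη : 0 < S.η) (hp : 0 < S.fixedPower T)
    (hQ : Q ∈ feasibleCov K N) (hA : S.IsBlockMaximizer T i Q A) (hB : B.PosSemidef) :
    S.dinkelbachDeriv T (Function.update Q i A) (Pi.single i (B - A)) ≤ 0 := by
  rw [← update_sub_update Q]
  refine dinkelbachDeriv_sub_nonpos_of_forall_ee_le hW hη hp (hA.update_mem hQ)
    (update_mem_feasibleCov hQ i hB) fun t ht ht1 => ?_
  have segment_eq : Function.update Q i A + t • (Function.update Q i B - Function.update Q i A) =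
      Function.update Q i (A + t • (B - A)) := by
    rw [← Function.update_sub, ← Function.update_smul, ← Function.update_add, sub_self, smul_zero,
      add_zero]
  rw [segment_eq]
  exact hA.2 _ (convex_setOf_posSemidef.add_smul_sub_mem hA.1 hB ⟨ht.le, ht1⟩)

theorem blockGrad_mul_eq (hW : 0 < S.W) (hη : 0 < S.η) (hp : 0 < S.fixedPower T)
    (hQ : Q ∈ feasibleCov K N) (hA : S.IsBlockMaximizer T i Q A) :
    S.blockGrad T (Function.update Q i A) i * A = (S.ee T (Function.update Q i A) / S.η) • A := by
  set P := Function.update Q i A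
  set G := (S.ee T P / S.η) • (1 : Matrix (Fin N) (Fin N) ℂ) - S.blockGrad T P i with hG
  have hGherm : G.IsHermitian :=
    (isHermitian_one.smul (IsSelfAdjoint.all _)).sub (isHermitian_blockGrad (hA.update_mem hQ) i)
  have isMinOn : IsMinOn (fun B => (G * B).trace.re) {B | B.PosSemidef} A := fun B hB => by
    have := hA.dinkelbachDeriv_nonpos hW hη hp hQ hB
    rw [dinkelbachDeriv_single, ← neg_sub, ← hG, Matrix.neg_mul, Matrix.mul_sub, trace_neg,
      trace_sub, Complex.neg_re, Complex.sub_re] at this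
    change (G * A).trace.re ≤ (G * B).trace.re
    linarith
  have slackness := (posSemidef_and_mul_eq_zero_of_isMinOn_re_trace_mul hGherm hA.1 isMinOn).2
  rw [hG, Matrix.sub_mul, Matrix.smul_mul, Matrix.one_mul] at slackness
  exact (sub_eq_zero.1 slackness).symm

theorem mem_channelRange (hσ : 0 < S.σ) (hW : 0 < S.W) (hη : 0 < S.η) (hp : 0 < S.fixedPower T)
    (hH : S.activeH T i ≠ 0) (hQ : Q ∈ feasibleCov K N) (hA : S.IsBlockMaximizer T i Q A) :
    A ∈ S.channelRange T i := by
  set P := Function.update Q i A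
  set D := S.blockGrad T P i with hD
  set l := S.ee T P / S.η
  have hl : l ≠ 0 := (div_pos (hA.ee_pos hσ hW hη hp hH hQ) hη).ne'
  have mul_eq : D * A = l • A := hA.blockGrad_mul_eq hW hη hp hQ
  have eq_mul_mul : A = (l⁻¹ * l⁻¹) • (D * A * D) := by
    have mul_eq' : A * D = l • A := by
      have := congrArg conjTranspose mul_eq
      rwa [conjTranspose_mul, conjTranspose_smul, star_trivial, hA.1.isHermitian.eq,
        (isHermitian_blockGrad (hA.update_mem hQ) i).eq] at this
    rw [mul_eq, Matrix.smul_mul, mul_eq', smul_smul l, ← mul_inv,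
      inv_smul_smul₀ (mul_ne_zero hl hl)]
  rw [eq_mul_mul]
  refine Submodule.smul_mem _ _ ?_
  rw [hD, blockGrad, Matrix.smul_mul, Matrix.smul_mul, Matrix.mul_smul]
  refine Submodule.smul_mem _ _ (Submodule.smul_mem _ _
    ⟨(S.macMatrix T P)⁻¹ * (S.activeH T i)ᴴ * A * S.activeH T i * (S.macMatrix T P)⁻¹, ?_⟩)
  simp only [ContinuousLinearMap.coe_coe, congruence_apply, Matrix.mul_assoc]

end IsBlockMaximizer

theorem exists_isBlockMaximizer (hσ : 0 < S.σ) (hW : 0 < S.W) (hη : 0 < S.η)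
    (hp : 0 < S.fixedPower T) (hH : S.activeH T i ≠ 0) (hQ : Q ∈ feasibleCov K N) :
    ∃ A, S.IsBlockMaximizer T i Q A := by
  have closed : IsClosed (Function.update Q i '' {A | A.PosSemidef}) :=
    (isClosedEmbedding_update Q i).isClosedMap _ isClosed_setOf_posSemidef
  obtain ⟨_, ⟨A, hA, rfl⟩, hmax⟩ := exists_isMaxOn_ee_of_isClosed hW hη hp closed
    (Set.image_subset_iff.2 fun A hA => update_mem_feasibleCov hQ i hA)
    ⟨_, ⟨1, PosSemidef.one, rfl⟩, ee_update_one_pos hσ hW hη hp hH hQ⟩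
  exact ⟨A, hA, fun B hB => hmax ⟨B, hB, rfl⟩⟩

theorem sq_norm_linPart_sub_le (hP : P ∈ feasibleCov K N) (hQ : Q ∈ feasibleCov K N) :
    ‖S.linPart T (Q - P)‖ ^ 2 ≤ 2 * ‖S.macMatrix T P‖ ^ 2 * (‖S.macMatrix T Q‖ + 1) *
      logDetDivergence (S.macMatrix T P) (S.macMatrix T Q) := by
  have := logDetDivergence_nonneg (posDef_macMatrix (S := S) (T := T) hP)
    (posDef_macMatrix (S := S) (T := T) hQ)
  rw [← macMatrix_sub]
  refine (sq_norm_sub_le_logDetDivergence (posDef_macMatrix hP) (posDef_macMatrix hQ)).trans ?_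
  gcongr
  exact mul_le_of_le_one_left (norm_nonneg _)
    (norm_inv_le_one_of_posSemidef_sub_one (posSemidef_macMatrix_sub_one hP))

theorem exists_bounds_of_le_ee (hW : 0 < S.W) (hη : 0 < S.η) (hp : 0 < S.fixedPower T)
    {α : ℝ} (hα : 0 < α) : ∃ R, 0 ≤ R ∧ ∀ Q ∈ feasibleCov K N, α ≤ S.ee T Q →
      ‖Q‖ ≤ R ∧ ‖S.macMatrix T Q‖ ≤ R ∧ S.totalPower T Q ≤ R := by
  obtain ⟨R, traceSum_le⟩ := exists_traceSum_le_of_le_ee (K := K) (N := N) hW hη hp hα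
  refine ⟨max |R| (max (‖(1 : Matrix T T ℂ)‖ + ‖S.linPart T‖ * |R|)
    (|R| / S.η + S.fixedPower T)), by positivity, fun Q hQ hαQ => ?_⟩
  have traceSum_le_abs := (traceSum_le Q hQ hαQ).trans (le_abs_self R)
  have norm_le := (norm_le_traceSum hQ).trans traceSum_le_abs
  refine ⟨le_max_of_le_left norm_le, le_max_of_le_right (le_max_of_le_left ?_),
    le_max_of_le_right (le_max_of_le_right ?_)⟩
  · rw [macMatrix_eq_one_add_linPart]
    refine (norm_add_le _ _).trans ?_
    gcongr
    exact (S.linPart T).le_opNorm_of_le norm_le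
  · rw [totalPower_eq]
    gcongr

theorem totalPower_mul_ee_sub_ge (hη : 0 < S.η) (hp : 0 < S.fixedPower T)
    (hP : P ∈ feasibleCov K N) (hQ : Q ∈ feasibleCov K N)
    (hderiv : S.dinkelbachDeriv T P (Q - P) ≤ 0) :
    S.natBandwidth * logDetDivergence (S.macMatrix T P) (S.macMatrix T Q) ≤
      S.totalPower T Q * (S.ee T P - S.ee T Q) := by
  rw [← totalPower_mul_ee_sub_add_logDetDivergence hη hp hP hQ] at hderiv
  linarith

theorem exists_sq_norm_linPart_sub_le (hW : 0 < S.W) (hη : 0 < S.η) (hp : 0 < S.fixedPower T)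
    {α : ℝ} (hα : 0 < α) : ∃ B, 0 ≤ B ∧ ∀ P ∈ feasibleCov K N, ∀ Q ∈ feasibleCov K N,
      α ≤ S.ee T Q → S.ee T Q ≤ S.ee T P → S.dinkelbachDeriv T P (Q - P) ≤ 0 →
      ‖S.linPart T (Q - P)‖ ^ 2 ≤ B * (S.ee T P - S.ee T Q) := by
  obtain ⟨R, hR, bounds⟩ := exists_bounds_of_le_ee (K := K) (N := N) hW hη hp hα
  have hκ := natBandwidth_pos hW
  refine ⟨2 * R ^ 2 * (R + 1) * (R / S.natBandwidth), by positivity,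
    fun P hP Q hQ hαQ hQP hderiv => ?_⟩
  obtain ⟨-, mac_Q_le, power_le⟩ := bounds Q hQ hαQ
  obtain ⟨-, mac_P_le, -⟩ := bounds P hP (hαQ.trans hQP)
  have ee_sub_nonneg := sub_nonneg.2 hQP
  have divergence_nonneg :=
    logDetDivergence_nonneg (posDef_macMatrix (S := S) (T := T) hP)
      (posDef_macMatrix (S := S) (T := T) hQ)
  have divergence_le : logDetDivergence (S.macMatrix T P) (S.macMatrix T Q) ≤
      R / S.natBandwidth * (S.ee T P - S.ee T Q) := by
    rw [div_mul_eq_mul_div, le_div_iff₀' hκ]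
    exact (totalPower_mul_ee_sub_ge hη hp hP hQ hderiv).trans (by gcongr)
  calc ‖S.linPart T (Q - P)‖ ^ 2 ≤ 2 * R ^ 2 * (R + 1) *
        logDetDivergence (S.macMatrix T P) (S.macMatrix T Q) :=
        (sq_norm_linPart_sub_le hP hQ).trans (by gcongr)
    _ ≤ 2 * R ^ 2 * (R + 1) * (R / S.natBandwidth * (S.ee T P - S.ee T Q)) := by gcongr
    _ = _ := by ring

theorem IsBlockMaximizer.exists_sq_norm_sub_le (hσ : 0 < S.σ) (hW : 0 < S.W) (hη : 0 < S.η)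
    (hp : 0 < S.fixedPower T) (hH : ∀ i, S.activeH T i ≠ 0) {α : ℝ} (hα : 0 < α) :
    ∃ C, 0 ≤ C ∧ ∀ Q ∈ feasibleCov K N, ∀ i A B, S.IsBlockMaximizer T i Q A → B.PosSemidef →
      B ∈ S.channelRange T i → α ≤ S.ee T (Function.update Q i B) →
      ‖B - A‖ ^ 2 ≤
        C * (S.ee T (Function.update Q i A) - S.ee T (Function.update Q i B)) := by
  obtain ⟨C, hC, norm_le⟩ := exists_norm_le_norm_linPart_single (S := S) (T := T) hσ
  obtain ⟨D, hD, sq_norm_le⟩ := exists_sq_norm_linPart_sub_le (K := K) (N := N) hW hη hp hα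
  refine ⟨C ^ 2 * D, by positivity, fun Q hQ i A B hA hB hBrange hαB => ?_⟩
  have linPart_le := sq_norm_le _ (hA.update_mem hQ) _ (update_mem_feasibleCov hQ i hB) hαB
    (hA.2 B hB) (by
      rw [update_sub_update]
      exact hA.dinkelbachDeriv_nonpos hW hη hp hQ hB)
  rw [update_sub_update] at linPart_le
  calc ‖B - A‖ ^ 2 ≤ (C * ‖S.linPart T (Pi.single i (B - A))‖) ^ 2 := by
        gcongr
        exact norm_le i _
          (Submodule.sub_mem _ hBrange (hA.mem_channelRange hσ hW hη hp (hH i) hQ))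
    _ = C ^ 2 * ‖S.linPart T (Pi.single i (B - A))‖ ^ 2 := mul_pow _ _ _
    _ ≤ C ^ 2 * (D * (S.ee T (Function.update Q i A) - S.ee T (Function.update Q i B))) := by
        gcongr
    _ = _ := (mul_assoc _ _ _).symm

theorem IsBlockMaximizer.eq (hσ : 0 < S.σ) (hW : 0 < S.W) (hη : 0 < S.η)
    (hp : 0 < S.fixedPower T) (hH : ∀ i, S.activeH T i ≠ 0) (hQ : Q ∈ feasibleCov K N)
    (hA : S.IsBlockMaximizer T i Q A) (hB : S.IsBlockMaximizer T i Q B) : B = A := by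
  obtain ⟨C, -, sq_norm_le⟩ := exists_sq_norm_sub_le hσ hW hη hp hH
    (hB.ee_pos hσ hW hη hp (hH i) hQ)
  have := sq_norm_le Q hQ i A B hA hB.1 (hB.mem_channelRange hσ hW hη hp (hH i) hQ) le_rfl
  rw [(hA.2 B hB.1).antisymm (hB.2 A hA.1), sub_self, mul_zero] at this
  exact sub_eq_zero.1 (norm_eq_zero.1 (sq_eq_zero_iff.1 (this.antisymm (sq_nonneg _))))

end BlockMaximizer

section Sweep

theorem midSweep_zero (Q P : CovTuple K N) : midSweep Q P 0 = Q := by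
  ext1 j
  simp [midSweep]

theorem midSweep_self (Q P : CovTuple K N) : midSweep Q P K = P := by
  ext1 j
  simp [midSweep]

theorem update_midSweep_old (Q P : CovTuple K N) (i : Fin K) :
    Function.update (midSweep Q P i) i (Q i) = midSweep Q P i := by
  rw [Function.update_eq_self_iff]
  simp [midSweep]

theorem update_midSweep_new (Q P : CovTuple K N) (i : Fin K) :
    Function.update (midSweep Q P i) i (P i) = midSweep Q P (i + 1) := by
  ext1 j
  obtain rfl | hj := eq_or_ne j i
  · simp [midSweep]
  · have lt_iff : (j : ℕ) < i ↔ (j : ℕ) < i + 1 := by omega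
    rw [Function.update_of_ne hj]
    simp only [midSweep, lt_iff]

theorem midSweep_mem_feasibleCov (hQ : Q ∈ feasibleCov K N) (hP : P ∈ feasibleCov K N) (m : ℕ) :
    midSweep Q P m ∈ feasibleCov K N := by
  intro j
  rw [midSweep]
  split_ifs
  exacts [hP j, hQ j]

theorem norm_sub_midSweep_le (Q P : CovTuple K N) (m : ℕ) : ‖P - midSweep Q P m‖ ≤ ‖P - Q‖ := by
  refine (pi_norm_le_iff_of_nonneg (norm_nonneg _)).2 fun j => ?_
  rw [Pi.sub_apply, midSweep]
  split_ifs
  · rw [sub_self, norm_zero]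
    exact norm_nonneg _
  · exact norm_le_pi_norm (P - Q) j

theorem midSweep_congr {P' : CovTuple K N} {m : ℕ} (h : ∀ j : Fin K, (j : ℕ) < m → P j = P' j) :
    midSweep Q P m = midSweep Q P' m := by
  ext1 j
  rw [midSweep, midSweep]
  split_ifs with hj
  exacts [h j hj, rfl]

/-- One sweep of iterative water-filling: `P` arises from `Q` by replacing the covariance matrices
of the users `1, …, K` one after the other by block maximizers. -/
def IsSweep (S : MIMOBC K N M) (T : Finset (Fin M)) (Q P : CovTuple K N) : Prop :=
  ∀ i : Fin K, S.IsBlockMaximizer T i (midSweep Q P i) (P i)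

namespace IsSweep

theorem mem_feasibleCov (h : S.IsSweep T Q P) : P ∈ feasibleCov K N :=
  fun i => (h i).1

theorem midSweep_mem (hQ : Q ∈ feasibleCov K N) (h : S.IsSweep T Q P) (m : ℕ) :
    midSweep Q P m ∈ feasibleCov K N :=
  midSweep_mem_feasibleCov hQ h.mem_feasibleCov m

theorem ee_midSweep_le_succ (hQ : Q ∈ feasibleCov K N) (h : S.IsSweep T Q P) (i : Fin K) :
    S.ee T (midSweep Q P i) ≤ S.ee T (midSweep Q P (i + 1)) := by
  have := (h i).2 (Q i) (hQ i)
  rwa [update_midSweep_new, update_midSweep_old] at this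

theorem ee_midSweep_mono (hQ : Q ∈ feasibleCov K N) (h : S.IsSweep T Q P) {a b : ℕ} (hab : a ≤ b)
    (hb : b ≤ K) : S.ee T (midSweep Q P a) ≤ S.ee T (midSweep Q P b) := by
  induction b, hab using Nat.le_induction with
  | base => exact le_rfl
  | succ b _ ih => exact (ih (by omega)).trans (h.ee_midSweep_le_succ hQ ⟨b, hb⟩)

theorem le_ee_midSweep (hQ : Q ∈ feasibleCov K N) (h : S.IsSweep T Q P) {m : ℕ} (hm : m ≤ K) :
    S.ee T Q ≤ S.ee T (midSweep Q P m) := by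
  have := h.ee_midSweep_mono hQ (Nat.zero_le m) hm
  rwa [midSweep_zero] at this

theorem ee_midSweep_le (hQ : Q ∈ feasibleCov K N) (h : S.IsSweep T Q P) {m : ℕ} (hm : m ≤ K) :
    S.ee T (midSweep Q P m) ≤ S.ee T P := by
  have := h.ee_midSweep_mono hQ hm le_rfl
  rwa [midSweep_self] at this

theorem ee_le (hQ : Q ∈ feasibleCov K N) (h : S.IsSweep T Q P) : S.ee T Q ≤ S.ee T P :=
  (h.le_ee_midSweep hQ le_rfl).trans (h.ee_midSweep_le hQ le_rfl)

theorem ee_pos (hσ : 0 < S.σ) (hW : 0 < S.W) (hη : 0 < S.η) (hp : 0 < S.fixedPower T)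
    (hH : S.activeH T i ≠ 0) (hQ : Q ∈ feasibleCov K N) (h : S.IsSweep T Q P) : 0 < S.ee T P := by
  have := (h i).ee_pos hσ hW hη hp hH (h.midSweep_mem hQ i)
  rw [update_midSweep_new] at this
  exact this.trans_le (h.ee_midSweep_le hQ i.2)

theorem mem_channelRange (hσ : 0 < S.σ) (hW : 0 < S.W) (hη : 0 < S.η) (hp : 0 < S.fixedPower T)
    (hH : S.activeH T i ≠ 0) (hQ : Q ∈ feasibleCov K N) (h : S.IsSweep T Q P) :
    P i ∈ S.channelRange T i :=
  (h i).mem_channelRange hσ hW hη hp hH (h.midSweep_mem hQ i)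

theorem exists_sq_norm_sub_le (hσ : 0 < S.σ) (hW : 0 < S.W) (hη : 0 < S.η)
    (hp : 0 < S.fixedPower T) (hH : ∀ i, S.activeH T i ≠ 0) {α : ℝ} (hα : 0 < α) :
    ∃ C, 0 ≤ C ∧ ∀ Q ∈ feasibleCov K N, ∀ P, S.IsSweep T Q P → (∀ i, Q i ∈ S.channelRange T i) →
      α ≤ S.ee T Q → ‖P - Q‖ ^ 2 ≤ C * (S.ee T P - S.ee T Q) := by
  obtain ⟨C, hC, sq_norm_le⟩ := IsBlockMaximizer.exists_sq_norm_sub_le hσ hW hη hp hH hα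
  refine ⟨C, hC, fun Q hQ P h hrange hαQ => ?_⟩
  have nonneg : 0 ≤ C * (S.ee T P - S.ee T Q) := mul_nonneg hC (sub_nonneg.2 (h.ee_le hQ))
  rw [← Real.le_sqrt (norm_nonneg _) nonneg]
  refine (pi_norm_le_iff_of_nonneg (Real.sqrt_nonneg _)).2 fun i => Real.le_sqrt_of_sq_le ?_
  have block := sq_norm_le _ (h.midSweep_mem hQ i) i (P i) (Q i) (h i) (hQ i) (hrange i)
  rw [update_midSweep_old, update_midSweep_new, norm_sub_rev] at block
  have le_mid := h.le_ee_midSweep hQ i.2.le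
  refine (block (hαQ.trans le_mid)).trans ?_
  gcongr
  exact h.ee_midSweep_le hQ i.2

theorem dinkelbachDeriv_nonpos (hW : 0 < S.W) (hη : 0 < S.η) (hp : 0 < S.fixedPower T)
    (hQ : Q ∈ feasibleCov K N) (h : S.IsSweep T Q P) (hB : B.PosSemidef) :
    S.dinkelbachDeriv T (midSweep Q P (i + 1)) (Pi.single i (B - P i)) ≤ 0 := by
  rw [← update_midSweep_new]
  exact (h i).dinkelbachDeriv_nonpos hW hη hp (h.midSweep_mem hQ i) hB

theorem exists_ee_sub_le (hW : 0 < S.W) (hη : 0 < S.η) (hp : 0 < S.fixedPower T) :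
    ∃ C, 0 ≤ C ∧ ∀ Q ∈ feasibleCov K N, ∀ P, S.IsSweep T Q P → ∀ Z ∈ feasibleCov K N,
      S.ee T Z - S.ee T P ≤ C * ‖P - Q‖ * ‖P - Z‖ := by
  obtain ⟨C, hC, deriv_sub_le⟩ := exists_norm_dinkelbachDeriv_sub_le (K := K) (N := N) hW hη hp
  refine ⟨K * C / S.fixedPower T, by positivity, fun Q hQ P h Z hZ => ?_⟩
  have block_le (i : Fin K) :
      S.dinkelbachDeriv T P (Pi.single i ((Z - P) i)) ≤ C * ‖P - Q‖ * ‖P - Z‖ := by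
    set X := midSweep Q P (i + 1)
    set Y : CovTuple K N := Pi.single i ((Z - P) i) with hY
    have deriv_nonpos : S.dinkelbachDeriv T X Y ≤ 0 :=
      h.dinkelbachDeriv_nonpos hW hη hp hQ (hZ i)
    have norm_single_le : ‖Y‖ ≤ ‖P - Z‖ := by
      rw [hY, Pi.norm_single, norm_sub_rev]
      exact norm_le_pi_norm _ i
    have deriv_sub_le_X : ‖S.dinkelbachDeriv T P - S.dinkelbachDeriv T X‖ ≤ C * ‖P - X‖ :=
      deriv_sub_le P h.mem_feasibleCov X (h.midSweep_mem hQ (i + 1))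
    calc S.dinkelbachDeriv T P Y ≤ S.dinkelbachDeriv T P Y - S.dinkelbachDeriv T X Y := by
          linarith
      _ ≤ ‖(S.dinkelbachDeriv T P - S.dinkelbachDeriv T X) Y‖ := Real.le_norm_self _
      _ ≤ C * ‖P - X‖ * ‖Y‖ := ContinuousLinearMap.le_of_opNorm_le _ deriv_sub_le_X Y
      _ ≤ C * ‖P - Q‖ * ‖P - Z‖ :=
          mul_le_mul (mul_le_mul_of_nonneg_left (norm_sub_midSweep_le Q P (i + 1)) hC)
            norm_single_le (norm_nonneg _) (mul_nonneg hC (norm_nonneg _))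
  have deriv_le : S.dinkelbachDeriv T P (Z - P) ≤ K * C * ‖P - Q‖ * ‖P - Z‖ := by
    calc S.dinkelbachDeriv T P (Z - P)
        = ∑ i, S.dinkelbachDeriv T P (Pi.single i ((Z - P) i)) := by
          rw [← map_sum, Finset.univ_sum_single]
      _ ≤ ∑ _i : Fin K, C * ‖P - Q‖ * ‖P - Z‖ := Finset.sum_le_sum fun i _ => block_le i
      _ = K * C * ‖P - Q‖ * ‖P - Z‖ := by
          rw [Finset.sum_const, Finset.card_univ, Fintype.card_fin, nsmul_eq_mul]
          ring
  rcases le_total (S.ee T Z) (S.ee T P) with hle | hle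
  · exact (sub_nonpos.2 hle).trans (by positivity)
  rw [div_mul_eq_mul_div, div_mul_eq_mul_div, le_div_iff₀' hp]
  calc S.fixedPower T * (S.ee T Z - S.ee T P) ≤ S.totalPower T Z * (S.ee T Z - S.ee T P) :=
        mul_le_mul_of_nonneg_right (fixedPower_le_totalPower hη hZ) (sub_nonneg.2 hle)
    _ ≤ S.dinkelbachDeriv T P (Z - P) :=
        totalPower_mul_ee_sub_le hW hη hp h.mem_feasibleCov hZ
    _ ≤ K * C * ‖P - Q‖ * ‖P - Z‖ := deriv_le

theorem eq {P' : CovTuple K N} (hσ : 0 < S.σ) (hW : 0 < S.W) (hη : 0 < S.η)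
    (hp : 0 < S.fixedPower T) (hH : ∀ i, S.activeH T i ≠ 0) (hQ : Q ∈ feasibleCov K N)
    (h : S.IsSweep T Q P) (h' : S.IsSweep T Q P') : P' = P := by
  have eq_at (m : ℕ) (i : Fin K) (hi : (i : ℕ) = m) : P' i = P i := by
    induction m using Nat.strong_induction_on generalizing i with
    | _ m ih =>
      have block' := h' i
      rw [midSweep_congr fun j hj => ih j (hi ▸ hj) j rfl] at block'
      exact (h i).eq hσ hW hη hp hH (h.midSweep_mem hQ i) block'
  exact funext fun i => eq_at i i rfl

end IsSweep

theorem exists_isSweep (hσ : 0 < S.σ) (hW : 0 < S.W) (hη : 0 < S.η) (hp : 0 < S.fixedPower T)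
    (hH : ∀ i, S.activeH T i ≠ 0) (hQ : Q ∈ feasibleCov K N) : ∃ P, S.IsSweep T Q P := by
  have exists_partial (m : ℕ) (hm : m ≤ K) : ∃ P ∈ feasibleCov K N, ∀ i : Fin K, (i : ℕ) < m →
      S.IsBlockMaximizer T i (midSweep Q P i) (P i) := by
    induction m with
    | zero => exact ⟨Q, hQ, fun i hi => absurd hi (Nat.not_lt_zero _)⟩
    | succ m ih =>
      obtain ⟨P, hP, h⟩ := ih (by omega)
      set i₀ : Fin K := ⟨m, hm⟩
      obtain ⟨A, hA⟩ := exists_isBlockMaximizer hσ hW hη hp (hH i₀)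
        (midSweep_mem_feasibleCov hQ hP m)
      refine ⟨Function.update P i₀ A, update_mem_feasibleCov hP i₀ hA.1, fun i hi => ?_⟩
      have midSweep_update : midSweep Q (Function.update P i₀ A) i = midSweep Q P i :=
        midSweep_congr fun j hj => Function.update_of_ne (Fin.ne_of_val_ne (by grind)) _ _
      rw [midSweep_update]
      obtain rfl | hne := eq_or_ne i i₀
      · rwa [Function.update_self]
      · rw [Function.update_of_ne hne]
        exact h i (by have := Fin.val_ne_of_ne hne; grind)
  obtain ⟨P, -, h⟩ := exists_partial K le_rfl
  exact ⟨P, fun i => h i i.2⟩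

end Sweep

end MIMOBC

/-! ### Convergence -/

section ErrorBound

open Matrix
open scoped Matrix.Norms.L2Operator

theorem posSemidef_blockDiagonal {n o : Type*} [Finite n] [Finite o] [DecidableEq o]
    {A : o → Matrix n n ℂ} (hA : ∀ i, (A i).PosSemidef) : (blockDiagonal A).PosSemidef := by
  cases nonempty_fintype n
  cases nonempty_fintype o
  classical
  choose B hB using fun i => exists_eq_conjTranspose_mul_self_of_posSemidef (hA i)
  have gram_eq : blockDiagonal A = (blockDiagonal B)ᴴ * blockDiagonal B := by
    rw [blockDiagonal_conjTranspose, ← blockDiagonal_mul]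
    exact congrArg blockDiagonal (funext hB)
  rw [gram_eq]
  exact posSemidef_conjTranspose_mul_self _

theorem holderErrorBound_feasibleCov {K N : ℕ} {F : Type*} [NormedAddCommGroup F]
    [NormedSpace ℝ F] (L : CovTuple K N →L[ℝ] F) {Q₀ : CovTuple K N}
    (hQ₀ : Q₀ ∈ feasibleCov K N) : HolderErrorBound (feasibleCov K N) L (L Q₀) := by
  let J : Matrix (Fin N × Fin K) (Fin N × Fin K) ℂ →L[ℝ] CovTuple K N :=
    (blockDiagAddMonoidHom _ _ _ ℂ).toRealLinearMap (Continuous.matrix_blockDiag continuous_id)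
  let P : CovTuple K N →L[ℝ] Matrix (Fin N × Fin K) (Fin N × Fin K) ℂ :=
    (blockDiagonalAddMonoidHom _ _ _ ℂ).toRealLinearMap continuous_id.matrix_blockDiagonal
  have J_P (Q : CovTuple K N) : J (P Q) = Q := blockDiag_blockDiagonal Q
  refine .of_retract (K' := {A | PosSemidef A}) J P (fun A hA i => hA.submatrix _)
    (fun Q hQ => posSemidef_blockDiagonal hQ) (fun Q _ => J_P Q) ?_
  have bound := holderErrorBound_posSemidef (L.comp J) (posSemidef_blockDiagonal hQ₀)
  have base_eq : L.comp J (blockDiagonal Q₀) = L Q₀ := congrArg L (J_P Q₀)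
  rwa [base_eq] at bound

end ErrorBound

namespace MIMOBC

open Matrix
open scoped Matrix.Norms.L2Operator

variable {K N M : ℕ} {S : MIMOBC K N M} {T : Finset (Fin M)} {P Q Q₀ : CovTuple K N}

section GlobalMaximizer

theorem dinkelbachDeriv_sub_nonpos_of_isMaxOn (hW : 0 < S.W) (hη : 0 < S.η)
    (hp : 0 < S.fixedPower T) (hP : P ∈ feasibleCov K N)
    (hmax : IsMaxOn (S.ee T) (feasibleCov K N) P) (hQ : Q ∈ feasibleCov K N) :
    S.dinkelbachDeriv T P (Q - P) ≤ 0 :=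
  dinkelbachDeriv_sub_nonpos_of_forall_ee_le hW hη hp hP hQ fun _ ht ht1 =>
    hmax (convex_feasibleCov.add_smul_sub_mem hP hQ ⟨ht.le, ht1⟩)

theorem ee_eq_of_linPart_eq_of_dinkelbachDeriv_eq (hη : 0 < S.η) (hp : 0 < S.fixedPower T)
    (hP : P ∈ feasibleCov K N) (hQ : Q ∈ feasibleCov K N)
    (h_linPart : S.linPart T Q = S.linPart T P)
    (h_deriv : S.dinkelbachDeriv T P Q = S.dinkelbachDeriv T P P) : S.ee T Q = S.ee T P := by
  have tangent := totalPower_mul_ee_sub_add_logDetDivergence hη hp hP hQ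
  rw [macMatrix_eq_one_add_linPart Q, h_linPart, ← macMatrix_eq_one_add_linPart,
    logDetDivergence_self, mul_zero, add_zero, map_sub, h_deriv, sub_self] at tangent
  exact sub_eq_zero.1 ((mul_eq_zero.1 tangent).resolve_left (totalPower_pos hη hp hQ).ne')

theorem exists_norm_linPart_dinkelbachDeriv_sub_le (hW : 0 < S.W) (hη : 0 < S.η)
    (hp : 0 < S.fixedPower T) (hQ₀ : Q₀ ∈ feasibleCov K N)
    (hmax : IsMaxOn (S.ee T) (feasibleCov K N) Q₀) {α : ℝ} (hα : 0 < α) :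
    ∃ C, 0 ≤ C ∧ ∀ Q ∈ feasibleCov K N, α ≤ S.ee T Q →
      ‖(S.linPart T).prod (S.dinkelbachDeriv T Q₀) (Q - Q₀)‖ ≤
        C * √(S.ee T Q₀ - S.ee T Q) := by
  obtain ⟨B, hB, sq_norm_le⟩ := exists_sq_norm_linPart_sub_le (K := K) (N := N) hW hη hp hα
  obtain ⟨R, hR, bounds⟩ := exists_bounds_of_le_ee (K := K) (N := N) hW hη hp hα
  refine ⟨max √B (R * √(S.ee T Q₀)), by positivity, fun Q hQ hαQ => ?_⟩
  have gap_nonneg : 0 ≤ S.ee T Q₀ - S.ee T Q := sub_nonneg.2 (hmax hQ)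
  have deriv_nonpos := dinkelbachDeriv_sub_nonpos_of_isMaxOn hW hη hp hQ₀ hmax hQ
  refine norm_prod_le_iff.2 ⟨?_, ?_⟩
  · calc ‖S.linPart T (Q - Q₀)‖ ≤ √(B * (S.ee T Q₀ - S.ee T Q)) :=
          Real.le_sqrt_of_sq_le (sq_norm_le Q₀ hQ₀ Q hQ hαQ (hmax hQ) deriv_nonpos)
      _ = √B * √(S.ee T Q₀ - S.ee T Q) := Real.sqrt_mul hB _
      _ ≤ _ := by
          gcongr
          exact le_max_left _ _
  · have tangent := totalPower_mul_ee_sub_le hW hη hp hQ₀ hQ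
    have gap_le : S.ee T Q₀ - S.ee T Q ≤ S.ee T Q₀ := by linarith
    calc ‖S.dinkelbachDeriv T Q₀ (Q - Q₀)‖ = -S.dinkelbachDeriv T Q₀ (Q - Q₀) :=
          Real.norm_of_nonpos deriv_nonpos
      _ ≤ S.totalPower T Q * (S.ee T Q₀ - S.ee T Q) := by linarith
      _ ≤ R * (√(S.ee T Q₀ - S.ee T Q) * √(S.ee T Q₀ - S.ee T Q)) := by
          rw [Real.mul_self_sqrt gap_nonneg]
          exact mul_le_mul_of_nonneg_right (bounds Q hQ hαQ).2.2 gap_nonneg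
      _ ≤ R * (√(S.ee T Q₀) * √(S.ee T Q₀ - S.ee T Q)) := by gcongr
      _ = R * √(S.ee T Q₀) * √(S.ee T Q₀ - S.ee T Q) := (mul_assoc _ _ _).symm
      _ ≤ _ := by
          gcongr
          exact le_max_right _ _

theorem exists_norm_sub_le_rpow_of_isMaxOn (hW : 0 < S.W) (hη : 0 < S.η)
    (hp : 0 < S.fixedPower T) (hQ₀ : Q₀ ∈ feasibleCov K N)
    (hmax : IsMaxOn (S.ee T) (feasibleCov K N) Q₀) {α : ℝ} (hα : 0 < α) :
    ∃ C γ : ℝ, 0 ≤ C ∧ 0 < γ ∧ γ ≤ 1 ∧ ∀ Q ∈ feasibleCov K N, α ≤ S.ee T Q →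
      ∃ Z ∈ feasibleCov K N, S.ee T Z = S.ee T Q₀ ∧
        ‖Q - Z‖ ≤ C * (S.ee T Q₀ - S.ee T Q) ^ γ := by
  set L := (S.linPart T).prod (S.dinkelbachDeriv T Q₀)
  obtain ⟨R, -, bounds⟩ := exists_bounds_of_le_ee (K := K) (N := N) hW hη hp hα
  obtain ⟨D, hD, residual_le⟩ :=
    exists_norm_linPart_dinkelbachDeriv_sub_le hW hη hp hQ₀ hmax hα
  obtain ⟨C, γ, hC, hγ, hγ1, error_bound⟩ := holderErrorBound_feasibleCov L hQ₀ R
  refine ⟨C * D ^ γ, γ / 2, by positivity, by positivity, by linarith, fun Q hQ hαQ => ?_⟩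
  obtain ⟨Z, hZ, L_Z, norm_le⟩ := error_bound Q hQ (bounds Q hQ hαQ).1
  have gap_nonneg : 0 ≤ S.ee T Q₀ - S.ee T Q := sub_nonneg.2 (hmax hQ)
  refine ⟨Z, hZ, ee_eq_of_linPart_eq_of_dinkelbachDeriv_eq hη hp hQ₀ hZ
    (congrArg Prod.fst L_Z) (congrArg Prod.snd L_Z), norm_le.trans ?_⟩
  rw [← map_sub]
  calc C * ‖L (Q - Q₀)‖ ^ γ ≤ C * (D * √(S.ee T Q₀ - S.ee T Q)) ^ γ := by
        gcongr
        exact residual_le Q hQ hαQ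
    _ = C * D ^ γ * (S.ee T Q₀ - S.ee T Q) ^ (γ / 2) := by
        rw [Real.mul_rpow hD (Real.sqrt_nonneg _), Real.sqrt_eq_rpow, ← Real.rpow_mul gap_nonneg,
          one_div_mul_eq_div, mul_assoc]

theorem exists_isMaxOn_ee (hσ : 0 < S.σ) (hW : 0 < S.W) (hη : 0 < S.η) (hp : 0 < S.fixedPower T)
    {i : Fin K} (hH : S.activeH T i ≠ 0) :
    ∃ Q ∈ feasibleCov K N, IsMaxOn (S.ee T) (feasibleCov K N) Q :=
  exists_isMaxOn_ee_of_isClosed hW hη hp isClosed_feasibleCov subset_rfl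
    ⟨_, update_mem_feasibleCov zero_mem_feasibleCov i PosSemidef.one,
      ee_update_one_pos hσ hW hη hp hH zero_mem_feasibleCov⟩

end GlobalMaximizer

namespace IsIterativeWaterfilling

variable {Q : ℕ → CovTuple K N}

theorem isSweep (h : S.IsIterativeWaterfilling T Q₀ Q) (k : ℕ) :
    S.IsSweep T (Q k) (Q (k + 1)) :=
  h.2 k

theorem mem_feasibleCov (hQ₀ : Q₀ ∈ feasibleCov K N) (h : S.IsIterativeWaterfilling T Q₀ Q) :
    ∀ k, Q k ∈ feasibleCov K N
  | 0 => h.1 ▸ hQ₀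
  | k + 1 => (h.isSweep k).mem_feasibleCov

theorem monotone_ee (hQ₀ : Q₀ ∈ feasibleCov K N) (h : S.IsIterativeWaterfilling T Q₀ Q) :
    Monotone fun k => S.ee T (Q k) :=
  monotone_nat_of_le_succ fun k => (h.isSweep k).ee_le (h.mem_feasibleCov hQ₀ k)

theorem summable_norm_sub [Nonempty (Fin K)] (hσ : 0 < S.σ) (hW : 0 < S.W) (hη : 0 < S.η)
    (hp : 0 < S.fixedPower T) (hH : ∀ i, S.activeH T i ≠ 0) (hQ₀ : Q₀ ∈ feasibleCov K N)
    (h : S.IsIterativeWaterfilling T Q₀ Q) : Summable fun k => ‖Q (k + 2) - Q (k + 1)‖ := by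
  obtain ⟨i⟩ := ‹Nonempty (Fin K)›
  have mem := h.mem_feasibleCov hQ₀
  have mono := h.monotone_ee hQ₀
  have le_ee (k : ℕ) : S.ee T (Q 1) ≤ S.ee T (Q (k + 1)) := mono (Nat.le_add_left 1 k)
  have ee_one_pos : 0 < S.ee T (Q 1) := (h.isSweep 0).ee_pos hσ hW hη hp (hH i) (mem 0)
  obtain ⟨Qm, hQm, hmax⟩ := exists_isMaxOn_ee (S := S) (N := N) hσ hW hη hp (hH i)
  obtain ⟨B, hB, sq_norm_le⟩ :=
    IsSweep.exists_sq_norm_sub_le (K := K) (N := N) hσ hW hη hp hH ee_one_pos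
  obtain ⟨C, hC, gap_le⟩ := IsSweep.exists_ee_sub_le (K := K) (N := N) hW hη hp
  obtain ⟨D, γ, hD, hγ, hγ1, dist_le⟩ :=
    exists_norm_sub_le_rpow_of_isMaxOn hW hη hp hQm hmax ee_one_pos
  refine summable_of_sufficient_decrease (r := fun k => S.ee T Qm - S.ee T (Q (k + 1)))
    (C := C * D) hB (mul_nonneg hC hD) hγ hγ1 (fun k => sub_nonneg.2 (hmax (mem _)))
    (fun a b hab => sub_le_sub_left (mono (Nat.add_le_add_right hab 1)) _)
    (fun _ => norm_nonneg _) (fun k => ?_) (fun k => ?_)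
  · rw [sub_sub_sub_cancel_left]
    exact sq_norm_le _ (mem _) _ (h.isSweep _)
      (fun j => (h.isSweep k).mem_channelRange hσ hW hη hp (hH j) (mem k)) (le_ee k)
  · obtain ⟨Z, hZ, ee_Z, norm_le⟩ := dist_le (Q (k + 2)) (mem _) (le_ee (k + 1))
    rw [← ee_Z] at norm_le ⊢
    calc S.ee T Z - S.ee T (Q (k + 2)) ≤ C * ‖Q (k + 2) - Q (k + 1)‖ * ‖Q (k + 2) - Z‖ :=
          gap_le _ (mem _) _ (h.isSweep _) Z hZ
      _ ≤ C * ‖Q (k + 2) - Q (k + 1)‖ * (D * (S.ee T Z - S.ee T (Q (k + 2))) ^ γ) := by gcongr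
      _ = _ := by ring

theorem exists_tendsto (hσ : 0 < S.σ) (hW : 0 < S.W) (hη : 0 < S.η) (hp : 0 < S.fixedPower T)
    (hH : ∀ i, S.activeH T i ≠ 0) (hQ₀ : Q₀ ∈ feasibleCov K N)
    (h : S.IsIterativeWaterfilling T Q₀ Q) : ∃ Z ∈ feasibleCov K N, Tendsto Q atTop (𝓝 Z) := by
  rcases isEmpty_or_nonempty (Fin K) with _ | _
  · rw [Subsingleton.elim Q fun _ => Q₀]
    exact ⟨Q₀, hQ₀, tendsto_const_nhds⟩
  have cauchySeq : CauchySeq fun k => Q (k + 1) := by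
    refine cauchySeq_of_summable_dist ((h.summable_norm_sub hσ hW hη hp hH hQ₀).congr fun k => ?_)
    rw [dist_comm, dist_eq_norm]
  obtain ⟨Z, tendsto_succ⟩ := cauchySeq_tendsto_of_complete cauchySeq
  have tendsto_Z : Tendsto Q atTop (𝓝 Z) := (tendsto_add_atTop_iff_nat 1).1 tendsto_succ
  exact ⟨Z, isClosed_feasibleCov.mem_of_tendsto tendsto_Z (.of_forall (h.mem_feasibleCov hQ₀)),
    tendsto_Z⟩

theorem tendsto_ee (hW : 0 < S.W) (hη : 0 < S.η) (hp : 0 < S.fixedPower T)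
    (hQ₀ : Q₀ ∈ feasibleCov K N) (h : S.IsIterativeWaterfilling T Q₀ Q)
    (hP : P ∈ feasibleCov K N) (hQP : Tendsto Q atTop (𝓝 P)) :
    Tendsto (fun k => S.ee T (Q k)) atTop (𝓝 (S.ee T P)) :=
  (continuousOn_ee hW hη hp P hP).tendsto.comp
    (tendsto_nhdsWithin_iff.2 ⟨hQP, .of_forall (h.mem_feasibleCov hQ₀)⟩)

theorem isMaxOn_of_tendsto (hW : 0 < S.W) (hη : 0 < S.η) (hp : 0 < S.fixedPower T)
    (hQ₀ : Q₀ ∈ feasibleCov K N) (h : S.IsIterativeWaterfilling T Q₀ Q)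
    (hP : P ∈ feasibleCov K N) (hQP : Tendsto Q atTop (𝓝 P)) :
    IsMaxOn (S.ee T) (feasibleCov K N) P := fun Z hZ => by
  obtain ⟨C, -, gap_le⟩ := IsSweep.exists_ee_sub_le (K := K) (N := N) hW hη hp
  have tendsto_succ : Tendsto (fun k => Q (k + 1)) atTop (𝓝 P) :=
    hQP.comp (tendsto_add_atTop_nat 1)
  have gap_tendsto : Tendsto (fun k => S.ee T Z - S.ee T (Q (k + 1))) atTop
      (𝓝 (S.ee T Z - S.ee T P)) :=
    tendsto_const_nhds.sub ((h.tendsto_ee hW hη hp hQ₀ hP hQP).comp (tendsto_add_atTop_nat 1))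
  have bound_tendsto : Tendsto (fun k => C * ‖Q (k + 1) - Q k‖ * ‖Q (k + 1) - Z‖) atTop
      (𝓝 (C * ‖P - P‖ * ‖P - Z‖)) :=
    ((tendsto_succ.sub hQP).norm.const_mul C).mul (tendsto_succ.sub tendsto_const_nhds).norm
  have gap_nonpos := le_of_tendsto_of_tendsto' gap_tendsto bound_tendsto fun k =>
    gap_le _ (h.mem_feasibleCov hQ₀ k) _ (h.isSweep k) Z hZ
  rw [sub_self P, norm_zero, mul_zero, zero_mul] at gap_nonpos
  exact sub_nonpos.1 gap_nonpos

end IsIterativeWaterfilling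

theorem existsUnique_isBlockMaximizer (hσ : 0 < S.σ) (hW : 0 < S.W) (hη : 0 < S.η)
    (hp : 0 < S.fixedPower T) (hH : ∀ i, S.activeH T i ≠ 0) (hQ : Q ∈ feasibleCov K N)
    (i : Fin K) : ∃! A, S.IsBlockMaximizer T i Q A := by
  obtain ⟨A, hA⟩ := exists_isBlockMaximizer hσ hW hη hp (hH i) hQ
  exact ⟨A, hA, fun B hB => hA.eq hσ hW hη hp hH hQ hB⟩

theorem existsUnique_isIterativeWaterfilling (hσ : 0 < S.σ) (hW : 0 < S.W) (hη : 0 < S.η)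
    (hp : 0 < S.fixedPower T) (hH : ∀ i, S.activeH T i ≠ 0) (hQ₀ : Q₀ ∈ feasibleCov K N) :
    ∃! Q, S.IsIterativeWaterfilling T Q₀ Q := by
  choose sweep isSweep_sweep using
    fun Q : feasibleCov K N => exists_isSweep hσ hW hη hp hH Q.2
  let F : ℕ → feasibleCov K N :=
    Nat.rec ⟨Q₀, hQ₀⟩ fun _ Q => ⟨sweep Q, (isSweep_sweep Q).mem_feasibleCov⟩
  have hF : S.IsIterativeWaterfilling T Q₀ fun k => (F k).1 :=
    ⟨rfl, fun k => isSweep_sweep (F k)⟩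
  refine ⟨_, hF, fun Q hQ => funext fun k => ?_⟩
  induction k with
  | zero => exact hQ.1
  | succ k ih => exact (hF.isSweep k).eq hσ hW hη hp hH (F k).2 (ih ▸ hQ.isSweep k)

end MIMOBC

theorem mainTheorem1 {K N M : ℕ} (S : MIMOBC K N M) (T : Finset (Fin M))
    (hσ : 0 < S.σ) (hW : 0 < S.W) (hη : 0 < S.η) (hP : 0 < S.fixedPower T)
    (hH : ∀ i, S.activeH T i ≠ 0) :
    (∀ Q ∈ feasibleCov K N, ∀ i : Fin K,
      ∃! A : Matrix (Fin N) (Fin N) ℂ, S.IsBlockMaximizer T i Q A) ∧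
    ∀ Q₀ ∈ feasibleCov K N,
      (∃! Q : ℕ → CovTuple K N, S.IsIterativeWaterfilling T Q₀ Q) ∧
      ∀ Q : ℕ → CovTuple K N, S.IsIterativeWaterfilling T Q₀ Q →
        (∀ (k : ℕ) (i : Fin K),
          S.ee T (midSweep (Q k) (Q (k + 1)) i) ≤ S.ee T (midSweep (Q k) (Q (k + 1)) (i + 1))) ∧
        Monotone (fun k => S.ee T (Q k)) ∧
        ∃ Qlim ∈ feasibleCov K N,
          Tendsto Q atTop (𝓝 Qlim) ∧
          Tendsto (fun k => S.ee T (Q k)) atTop (𝓝 (S.ee T Qlim)) ∧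
          IsMaxOn (S.ee T) (feasibleCov K N) Qlim := by
  refine ⟨fun Q hQ => MIMOBC.existsUnique_isBlockMaximizer hσ hW hη hP hH hQ,
    fun Q₀ hQ₀ => ⟨MIMOBC.existsUnique_isIterativeWaterfilling hσ hW hη hP hH hQ₀,
      fun Q hQ => ⟨fun k => (hQ.isSweep k).ee_midSweep_le_succ (hQ.mem_feasibleCov hQ₀ k),
        hQ.monotone_ee hQ₀, ?_⟩⟩⟩
  obtain ⟨Qlim, hQlim, tendsto_Qlim⟩ := hQ.exists_tendsto hσ hW hη hP hH hQ₀
  exact ⟨Qlim, hQlim, tendsto_Qlim, hQ.tendsto_ee hW hη hP hQ₀ hQlim tendsto_Qlim,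
    hQ.isMaxOn_of_tendsto hW hη hP hQ₀ hQlim tendsto_Qlim⟩
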